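/- Notation. Let $'=\partial_x$ and let $\mathcal L=\partial_x^2-u$. For $k\ge 0$ let $A_k=\partial_x^{2k+1}+\dots$ be the unique anti-symmetric differential operator of order $2k+1$ with leading coefficient $1$ whose coefficients are differential polynomials in $u$, which is homogeneous of degree $2k+1$ for the grading $\deg\partial_x=1$, $\deg u^{(j)}=j+2$, and for which $[\mathcal L,A_k]$ is the operator of multiplication by a differential polynomial; call the latter $r_k[u]$ (so $r_0=u'$, $r_1=\frac14(u'''-6uu')$, …). For $g\ge1$ and complex constants $a=(a_0,\dots,a_{g-2})$ the stationary $g$-KdV equation is $$ r_g[u]+\sum_{k=0}^{g-2}a_k\,r_k[u]=0. \tag{1}$$ Let $1\le m\le g$, let $U\subset\mathbb K^m$ ($\mathbb K=\mathbb R$ or $\mathbb C$) be open and connected (non-empty), with coordinates $t_1=x,t_2,\dots,t_m$, and let $u:U\to\mathbb C$ be smooth (over $\mathbb K$), satisfying (1) in the variable $x$ and following the KdV flows in the remaining times, $$\partial_{t_{k+1}}u=r_k[u]+\sum_{i=2}^{k}a_{g-i}\,r_{k-i}[u],\qquad 1\le k\le m-1 .$$ (For $m=1$ the function $u$ is just a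 solution of the ordinary differential equation (1); $m=g$ is the case of all the times.) For smooth functions $u_1=u,u_2,\dots,u_g$ on $U$ and constants $\mu_1,\dots,\mu_{2g}\in\mathbb C$ put $\mathbf u(\xi)=\sum_{i=1}^g u_i\xi^i$, $\mu(\xi)=4\xi^{-1}+\sum_{i=1}^{2g}\mu_i\xi^i$, and consider the equation $$4\mu(\xi)=\mathbf u'(\xi)^2+2\mathbf u''(\xi)\,(2-\mathbf u(\xi))+4(\xi^{-1}+u_1)(2-\mathbf u(\xi))^2 \tag{2}$$ identically in $\xi$ on $U$, and the relations $$\mu_k=8a_{g-k-1}+4\sum_{i=1}^{k-2}a_{g-i-1}\,a_{g-k+i},\qquad 1\le k\le g-1. \tag{3}$$ Equating in (2) the coefficients at $\xi^k$, in which $u_{k+1}$ enters only through the term $-16u_{k+1}$, defines recursively, for given constants $\mu_1,\mu_2,\dots$, differential polynomials $\Theta_1=u$ and $\Theta_{k+1}=\Theta_{k+1}(u,u',\dots,u^{(2k)},\mu_1,\dots,\mu_{k})$. Statement. (a) There is exactly one (possibly singular) hyperelliptic curve $$\Gamma=\{(\xi,y)\in\mathbb C^2 : \xi\ne0,\ y^2=4\mu(\xi)\}$$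 whose coefficients $\mu_i$ satisfy (2) and (3) for some smooth functions $u_1=u,u_2,\dots,u_g$ on $U$. (b) Whenever $u_1=u,u_2,\dots,u_g$ and $\mu_1,\dots,\mu_{2g}$ satisfy (2) and (3), one has $u_k=\Theta_k(u,u',\dots,u^{(2k-2)},\mu_1,\dots,\mu_{k-1})$ on $U$ for $1\le k\le g$, $\partial_{t_k}u=u_k'$ for $1\le k\le m$, and for every $t_0\in U$ and every $k=g,\dots,2g$ the constant $\mu_k$ is obtained from $a$ and the initial values $u^{(j)}(t_0)$ ($x$-derivatives, $j=0,1,\dots$) as follows: substitute $u_i=\Theta_i$ ($1\le i\le g$), with $\mu_1,\dots,\mu_{g-1}$ given by (3), into the right-hand side of (2), take one quarter of the coefficient at $\xi^k$, and evaluate it at $u^{(j)}=u^{(j)}(t_0)$. In particular $u_2,\dots,u_g$ and $\mu_1,\dots,\mu_{2g}$ are uniquely determined by $u$ and $a$, and $\mu_1,\dots,\mu_{2g}$ by $a$ and the initial values. (c) If $u$ satisfies (1) for no other choice of the constants $a_0,\dots,a_{g-2}$, then (3) follows from (2): for all $u_1=u,u_2,\dots,u_g$ and $\mu_1,\dots,\mu_{2g}$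 that satisfy (2), the relations (3) hold. -/

import Mathlib

open scoped ContDiff

noncomputable section

/-- Differential polynomials in one function `u`: the variable `X j` stands for the `j`-th
derivative of `u` with respect to `x`. -/
abbrev DiffPoly : Type := MvPolynomial ℕ ℂ

namespace DiffPoly

/-- The total derivative `d/dx`, with `X j ↦ X (j+1)`. -/
def D : Derivation ℂ DiffPoly DiffPoly :=
  MvPolynomial.mkDerivation ℂ (fun j => MvPolynomial.X (j + 1))

/-- `d/dx` as an operator on differential polynomials. -/
def dx : Module.End ℂ DiffPoly := D.toLinearMap

/-- The operator of multiplication by `f`. -/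
def mulOp (f : DiffPoly) : Module.End ℂ DiffPoly := LinearMap.mulLeft ℂ f

/-- The ordinary differential operator `∑ pᵢ ∂ₓⁱ`, where `pᵢ = p.coeff i`. The action on
differential polynomials is faithful: an operator determines its coefficients. -/
def diffOp (p : Polynomial DiffPoly) : Module.End ℂ DiffPoly :=
  p.sum fun i c => mulOp c * dx ^ i

/-- The formal conjugate `∑ (-∂ₓ)ⁱ pᵢ` of the operator `∑ pᵢ ∂ₓⁱ`. -/
def diffOpAdj (p : Polynomial DiffPoly) : Module.End ℂ DiffPoly :=
  p.sum fun i c => (-dx) ^ i * mulOp c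

/-- The Schrödinger operator `∂ₓ² - u`. -/
def schrodinger : Module.End ℂ DiffPoly := dx ^ 2 - mulOp (MvPolynomial.X 0)

/-- `A = diffOp p` is the operator `A_k` of the KdV hierarchy and `r = [L, A_k]`: `A` has order
`2k+1` and leading coefficient `1`, it is homogeneous of degree `2k+1` for the grading
`deg u⁽ʲ⁾ = j + 2`, `deg ∂ₓ = 1`, it is anti-symmetric, and its commutator with the Schrödinger
operator is the operator of multiplication by `r`. -/
structure IsLaxPair (k : ℕ) (p : Polynomial DiffPoly) (r : DiffPoly) : Prop where
  natDegree_eq : p.natDegree = 2 * k + 1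
  monic : p.Monic
  homogeneous : ∀ i ≤ 2 * k + 1,
    MvPolynomial.IsWeightedHomogeneous (fun j : ℕ => j + 2) (p.coeff i) (2 * k + 1 - i)
  antisymmetric : diffOpAdj p = -diffOp p
  commutator : schrodinger * diffOp p - diffOp p * schrodinger = mulOp r

/-- The right-hand side `r_k[u]` of the `k`-th higher KdV equation: `r_0 = u'`,
`r_1 = (u''' - 6uu')/4`, and so on. -/
def kdv (k : ℕ) : DiffPoly := Classical.epsilon fun r => ∃ p, IsLaxPair k p r

/-- The left-hand side `r_g + ∑_{k=0}^{g-2} a_k r_k` of the stationary `g`-KdV equation. -/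
def stationary (g : ℕ) (a : ℕ → ℂ) : DiffPoly :=
  kdv g + ∑ k ∈ Finset.range (g - 1), MvPolynomial.C (a k) * kdv k

/-- The `x`-derivative of `u_{k+1}`: the right-hand side
`r_k + a_{g-2} r_{k-2} + a_{g-3} r_{k-3} + ⋯ + a_{g-k} r_0` of the evolution
equation of `u` in the time `t_{k+1}`. -/
def flow (g : ℕ) (a : ℕ → ℂ) (k : ℕ) : DiffPoly :=
  kdv k + ∑ i ∈ Finset.Icc 2 k, MvPolynomial.C (a (g - i)) * kdv (k - i)

end DiffPoly

/-- The generating function `∑_{i=1}^{g} wᵢ ξⁱ`. -/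
def genFun {R : Type*} [CommRing R] (g : ℕ) (w : ℕ → R) : Polynomial R :=
  ∑ i ∈ Finset.Icc 1 g, Polynomial.C (w i) * Polynomial.X ^ i

/-- `ξ` times the expression `w'² + 2 w'' (2 - w) + 4 (ξ⁻¹ + u₁) (2 - w)²`, where `w`, `w'`, `w''`
are polynomials in `ξ`. -/
def curveExpr {R : Type*} [CommRing R] (u₁ : R) (w w' w'' : Polynomial R) : Polynomial R :=
  Polynomial.X * (w' ^ 2 + 2 * w'' * (2 - w))
    + 4 * (1 + Polynomial.C u₁ * Polynomial.X) * (2 - w) ^ 2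

namespace DiffPoly

/-- The coefficient at `ξᵏ` of `w'² + 2 w'' (2 - w) + 4 (ξ⁻¹ + u) (2 - w)²`,
`w = ∑_{i=1}^{g} wᵢ ξⁱ`, where the `wᵢ` are differential polynomials in `u`. -/
def curveCoeff (g : ℕ) (w : ℕ → DiffPoly) (k : ℕ) : DiffPoly :=
  (curveExpr (MvPolynomial.X 0) (genFun g w) (genFun g fun i => D (w i))
    (genFun g fun i => D (D (w i)))).coeff (k + 1)

/-- The differential polynomials `Θ_k` with `u_k = Θ_k(u, u', …, u⁽²ᵏ⁻²⁾, μ_1, …, μ_{k-1})`: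
`Θ_1 = u`, and `Θ_{k+1}` is found by equating the coefficients at `ξᵏ` in
`4 μ(ξ) = w'² + 2 w'' (2 - w) + 4 (ξ⁻¹ + u) (2 - w)²`, in which
`u_{k+1}` enters through the term `-16 u_{k+1}` only. -/
def Theta (μ : ℕ → ℂ) : ℕ → DiffPoly
  | 0 => 0
  | 1 => MvPolynomial.X 0
  | k + 2 =>
      MvPolynomial.C (1 / 16) *
        (curveCoeff (k + 1) (fun i => if _h : i < k + 2 then Theta μ i else 0) (k + 1)
          - MvPolynomial.C (4 * μ (k + 1)))

end DiffPoly

/-- `μ_k = 8 a_{g-k-1} + 4 ∑_{i=1}^{k-2} a_{g-i-1} a_{g-k+i}`, to be used for `1 ≤ k ≤ g - 1`. -/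
def muOfConstants (g : ℕ) (a : ℕ → ℂ) (k : ℕ) : ℂ :=
  8 * a (g - k - 1) + 4 * ∑ i ∈ Finset.Icc 1 (k - 2), a (g - i - 1) * a (g - k + i)

/-- The value of `μ_k`, `g ≤ k ≤ 2g`, in terms of `a` and of the initial values
`c j = u⁽ʲ⁾(t₀)`: one quarter of the coefficient at `ξᵏ` of
`w'² + 2 w'' (2 - w) + 4 (ξ⁻¹ + u) (2 - w)²`, after the substitution `u_i = Θ_i`, `1 ≤ i ≤ g`. -/
def muOfInitialValues (g : ℕ) (a c : ℕ → ℂ) (k : ℕ) : ℂ :=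
  1 / 4 * MvPolynomial.eval c
    (DiffPoly.curveCoeff g (DiffPoly.Theta (muOfConstants g a)) k)

/-- The curve `y² = 4 μ(ξ)`, `μ(ξ) = 4 ξ⁻¹ + ∑_{i=1}^{2g} μ_i ξⁱ`. -/
def hyperellipticCurve (g : ℕ) (μ : ℕ → ℂ) : Set (ℂ × ℂ) :=
  {q | q.1 ≠ 0 ∧ q.2 ^ 2 = 4 * (4 * q.1⁻¹ + ∑ i ∈ Finset.Icc 1 (2 * g), μ i * q.1 ^ i)}

section Functions

variable {𝕜 : Type*} [RCLike 𝕜] [NormedAlgebra 𝕜 ℂ] {n : ℕ}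

/-- The partial derivative in the `k`-th variable; the variables `t_1 = x, t_2, …, t_{n+1}` have
the indices `0, 1, …, n`. -/
def pderiv (k : Fin (n + 1)) (f : (Fin (n + 1) → 𝕜) → ℂ) (t : Fin (n + 1) → 𝕜) : ℂ :=
  fderiv 𝕜 f t (Pi.single k 1)

/-- The sequence of the values at `t` of the `x`-derivatives of `u`. -/
def xjet (u : (Fin (n + 1) → 𝕜) → ℂ) (t : Fin (n + 1) → 𝕜) (j : ℕ) : ℂ :=
  ((pderiv 0)^[j] u) t

/-- `u` satisfies on `U` the stationary `g`-KdV equation with constants `a_0, …, a_{g-2}`. -/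
def IsStationarySolution (g : ℕ) (a : ℕ → ℂ) (U : Set (Fin (n + 1) → 𝕜))
    (u : (Fin (n + 1) → 𝕜) → ℂ) : Prop :=
  ∀ t ∈ U, MvPolynomial.eval (xjet u t) (DiffPoly.stationary g a) = 0

/-- `u` depends on the times `t_1 = x, t_2, …, t_{n+1}` through the KdV flows. For the time
`t_1 = x` alone (`n = 0`) the condition is void. -/
def FollowsFlows (g : ℕ) (a : ℕ → ℂ) (U : Set (Fin (n + 1) → 𝕜))
    (u : (Fin (n + 1) → 𝕜) → ℂ) : Prop :=
  ∀ k : Fin (n + 1), ∀ t ∈ U,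
    pderiv k u t = MvPolynomial.eval (xjet u t) (DiffPoly.flow g a k)

/-- The functions `u_1 = u, u_2, …, u_g` and the constants `μ_1, …, μ_{2g}` satisfy on `U`
`4 μ(ξ) = 𝐮'(ξ)² + 2 𝐮''(ξ) (2 - 𝐮(ξ)) + 4 (ξ⁻¹ + u_1) (2 - 𝐮(ξ))²`, where
`𝐮(ξ) = ∑_{i=1}^{g} u_i ξⁱ` and `μ(ξ) = 4 ξ⁻¹ + ∑_{i=1}^{2g} μ_i ξⁱ`. Both sides are multiplied
by `ξ`, which makes them polynomials in `ξ`. -/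
structure IsCurveData (g : ℕ) (U : Set (Fin (n + 1) → 𝕜)) (u : (Fin (n + 1) → 𝕜) → ℂ)
    (v : ℕ → (Fin (n + 1) → 𝕜) → ℂ) (μ : ℕ → ℂ) : Prop where
  smooth : ∀ i ∈ Finset.Icc 1 g, ContDiffOn 𝕜 ∞ (v i) U
  first : ∀ t ∈ U, v 1 t = u t
  equation : ∀ t ∈ U,
    4 * (Polynomial.C 4
        + ∑ i ∈ Finset.Icc 1 (2 * g), Polynomial.C (μ i) * Polynomial.X ^ (i + 1))
      = curveExpr (u t) (genFun g fun i => xjet (v i) t 0) (genFun g fun i => xjet (v i) t 1)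
          (genFun g fun i => xjet (v i) t 2)

end Functions

end

open scoped ContDiff

noncomputable section

open PowerSeries (coeff)
open scoped PowerSeries

/-! ### The ring of differential polynomials: constants of D and the weight grading. -/

namespace DiffPoly

open MvPolynomial (C X constantCoeff IsWeightedHomogeneous)

/-! Put F = 2 - ∑ Θ_k ξᵏ, a series over the differential polynomials. Multiplied by ξ, the curve
equation says that Q(F) = ξ(F'² - 2FF'') + 4(1 + uξ)F² (`curveForm`) is a constant series. Since
Q(F)' = 2F·Λ(F) with Λ = -ξ∂³ + 4(1 + uξ)∂ + 2u'ξ (`lenard`), this is the integrated form of the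
Lenard recursion Λ(F) = 0. For m ≥ 1 the top coefficient F_m enters Q at ξᵐ only through 8F_0F_m, so
Q(F) and F_0 = 2 determine F.

A constant factor c multiplies Q by c². Hence F is c times the solution F⁰ for μ = 0, where c² = 1 +
∑ μ_k ξᵏ⁺¹/4 (`thetaSeries_eq`), and the relations (3) mean c_i = a_{g-i} for 2 ≤ i ≤ g
(`mu_eq_muOfConstants_iff`). The operators ∑ (2h_j∂ - h_j')L^{k-j} with h_j = F⁰_j/4 have
telescoping commutators with L, which identifies r_k with (Θ⁰_{k+1})' (`kdv_eq`). So under (3)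
Θ_{k+1}' is the flow number k for k ≤ g, and for k = g it is the left side of the stationary
equation.

For given curve data, the low coefficients of (2) force u_k = Θ_k, and the coefficients from ξᵍ on
give the remaining μ_k. Differentiating (2) gives Λ(T) = 0 for the truncation T of F at order g; at
ξᵍ⁺¹ this is a stationary equation with constants read off from c, whence (c).

For existence, Q(T) must not vary in any of the times. If P is F truncated at order k, then 2ξᵏ ∂F =
PF' - P'F for the derivative ∂ along the flow of F_{k+1} (`two_mul_X_pow_mul_seriesDer_evol`). At a
given point of U a constant factor 1 + O(ξᵍ⁺¹) makes all F_s with s > g vanish; by the stationary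
equation and the recursion their x-derivatives vanish too. The ideal generated by these F_s and
their derivatives is stable under D and under the flows, and Q(T) is congruent modulo it to the
constant Q(F). So the flow derivatives of Q(T) vanish at the point (`eval_evol_flow_curveCoeff`). -/

@[simp] theorem D_X (j : ℕ) : D (X j) = X (j + 1) :=
  MvPolynomial.mkDerivation_X ℂ _ j

@[simp] theorem D_C (c : ℂ) : D (C c) = 0 := by
  have := D.map_algebraMap c
  rwa [MvPolynomial.algebraMap_eq] at this

theorem D_C_mul (c : ℂ) (f : DiffPoly) : D (C c * f) = C c * D f := by
  simp [Derivation.leibniz]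

theorem pderiv_succ_D (j : ℕ) (f : DiffPoly) :
    MvPolynomial.pderiv (j + 1) (D f)
      = D (MvPolynomial.pderiv (j + 1) f) + MvPolynomial.pderiv j f := by
  have h : ⁅MvPolynomial.pderiv (R := ℂ) (j + 1), D⁆ = MvPolynomial.pderiv j := by
    refine MvPolynomial.derivation_ext fun i => ?_
    rw [Derivation.commutator_apply, D_X]
    by_cases hij : i = j
    · subst hij
      rw [MvPolynomial.pderiv_X_self, MvPolynomial.pderiv_X_self,
        MvPolynomial.pderiv_X_of_ne (by omega)]
      simp
    · rw [MvPolynomial.pderiv_X_of_ne (by omega), MvPolynomial.pderiv_X_of_ne hij]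
      by_cases h2 : i = j + 1
      · subst h2; simp
      · rw [MvPolynomial.pderiv_X_of_ne h2]; simp
  have := congrArg (fun d => d f) h
  simp only [Derivation.commutator_apply] at this
  rw [← this]; ring

theorem exists_pderiv_eq_zero (f : DiffPoly) :
    ∃ N, ∀ j ≥ N, MvPolynomial.pderiv j f = 0 := by
  refine ⟨f.vars.sup id + 1, fun j hj => MvPolynomial.pderiv_eq_zero_of_notMem_vars fun h => ?_⟩
  have : j ≤ f.vars.sup id := Finset.le_sup (f := id) h
  omega

theorem pderiv_D_eq_zero {f : DiffPoly} {N : ℕ} (h : ∀ j ≥ N, MvPolynomial.pderiv j f = 0) :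
    ∀ j ≥ N + 1, MvPolynomial.pderiv j (D f) = 0 := by
  intro j hj
  obtain ⟨i, rfl⟩ : ∃ i, j = i + 1 := ⟨j - 1, by omega⟩
  rw [pderiv_succ_D, h _ (by omega), h _ (by omega), map_zero, add_zero]

theorem pderiv_D_iterate_eq_zero {f : DiffPoly} {N : ℕ}
    (h : ∀ j ≥ N, MvPolynomial.pderiv j f = 0) (i : ℕ) :
    ∀ j ≥ N + i, MvPolynomial.pderiv j (D^[i] f) = 0 := by
  induction i with
  | zero => exact h
  | succ i ih =>
    intro j hj
    rw [Function.iterate_succ_apply']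
    exact pderiv_D_eq_zero ih j (by omega)

theorem eq_C_of_pderiv_eq_zero {f : DiffPoly} (h : ∀ j, MvPolynomial.pderiv j f = 0) :
    f = C (constantCoeff f) := by
  ext m
  rw [MvPolynomial.coeff_C]
  split_ifs with hm
  · rw [← hm]; rfl
  · obtain ⟨j, hj⟩ : ∃ j, m j ≠ 0 := by
      by_contra! hc
      exact hm (Finsupp.ext fun i => (hc i).symm)
    have h1 := congrArg (MvPolynomial.coeff (m - Finsupp.single j 1)) (h j)
    rw [MvPolynomial.coeff_pderiv] at h1
    have h2 : m - Finsupp.single j 1 + Finsupp.single j 1 = m := by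
      ext i
      by_cases hi : j = i
      · subst hi; simp; omega
      · simp [hi]
    rw [h2] at h1
    have h3 : ((m j - 1 : ℕ) : ℂ) + 1 ≠ 0 := Nat.cast_add_one_ne_zero _
    simpa [h3] using h1

/-- The constants of the differential ring of differential polynomials. -/
theorem eq_C_of_D_eq_zero {f : DiffPoly} (h : D f = 0) : f = C (constantCoeff f) := by
  obtain ⟨N, hN⟩ := exists_pderiv_eq_zero f
  refine eq_C_of_pderiv_eq_zero ?_
  -- Descent from a large index: ∂/∂u⁽ʲ⁾ is the commutator of ∂/∂u⁽ʲ⁺¹⁾ with D, so when D f = 0 the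
  -- vanishing of the derivative in u⁽ʲ⁺¹⁾ passes to u⁽ʲ⁾.
  have key : ∀ n ≤ N, ∀ j ≥ N - n, MvPolynomial.pderiv j f = 0 := by
    intro n
    induction n with
    | zero => intro _ j hj; exact hN j hj
    | succ n ih =>
      intro hn j hj
      have h1 := ih (by omega) (j + 1) (by omega)
      have h2 := pderiv_succ_D j f
      rw [h, h1] at h2
      simpa using h2.symm
  exact fun j => key N le_rfl j (by omega)

theorem constantCoeff_mkDerivation (F : ℕ → DiffPoly) (hF : ∀ j, constantCoeff (F j) = 0)
    (f : DiffPoly) : constantCoeff (MvPolynomial.mkDerivation ℂ F f) = 0 := by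
  induction f using MvPolynomial.induction_on with
  | C a => simp
  | add p q hp hq => simp [hp, hq]
  | mul_X p n hp => simp [Derivation.leibniz, hp, hF]

@[simp] theorem constantCoeff_D (f : DiffPoly) : constantCoeff (D f) = 0 :=
  constantCoeff_mkDerivation _ (fun _ => MvPolynomial.constantCoeff_X ℂ _) f

/-- The grading `deg u⁽ʲ⁾ = j + 2`. -/
abbrev Homog (f : DiffPoly) (e : ℕ) : Prop := IsWeightedHomogeneous (fun j : ℕ => j + 2) f e

theorem Homog.D {f : DiffPoly} {e : ℕ} (h : Homog f e) : Homog (DiffPoly.D f) (e + 1) := by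
  rw [f.as_sum, map_sum]
  refine (MvPolynomial.weightedHomogeneousSubmodule ℂ (fun j : ℕ => j + 2) (e + 1)).sum_mem ?_
  intro m hm
  have hw := h (MvPolynomial.mem_support_iff.1 hm)
  rw [DiffPoly.D, MvPolynomial.mkDerivation_monomial]
  refine Submodule.smul_mem _ _ (Submodule.sum_mem _ fun i hi => ?_)
  change Homog _ _
  dsimp only
  rw [smul_eq_mul]
  have h1 : Homog (MvPolynomial.monomial (m - Finsupp.single i 1) ((m i : ℕ) : ℂ))
      (Finsupp.weight (fun j : ℕ => j + 2) (m - Finsupp.single i 1)) :=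
    MvPolynomial.isWeightedHomogeneous_monomial _ _ _ rfl
  have h2 := h1.mul (MvPolynomial.isWeightedHomogeneous_X ℂ (fun j : ℕ => j + 2) (i + 1))
  have h3 : m - Finsupp.single i 1 + Finsupp.single i 1 = m := by
    have := Finsupp.mem_support_iff.1 hi
    ext j
    by_cases hj : i = j
    · subst hj; simp; omega
    · simp [hj]
  have h4 := congrArg (Finsupp.weight (fun j : ℕ => j + 2)) h3
  rw [map_add, hw, Finsupp.weight_single] at h4
  convert h2 using 1
  simp at h4
  omega

theorem Homog.constantCoeff_eq_zero {f : DiffPoly} {e : ℕ} (h : Homog f e) (he : e ≠ 0) :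
    constantCoeff f = 0 := by
  by_contra hc
  have := h (d := 0) hc
  simp at this
  exact he this.symm

theorem Homog.eq_C {f : DiffPoly} (h : Homog f 0) : f = C (constantCoeff f) := by
  ext m
  rw [MvPolynomial.coeff_C]
  split_ifs with hm
  · rw [← hm]; rfl
  · by_contra hc
    have h1 := h hc
    rw [Finsupp.weight_apply, Finsupp.sum, Finset.sum_eq_zero_iff] at h1
    refine hm (Finsupp.ext fun i => ?_)
    by_contra hi
    have := h1 i (Finsupp.mem_support_iff.2 fun h0 => hi (by simp [h0]))
    simp at this
    exact hi (by simp [this])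

theorem homog_zero (e : ℕ) : Homog 0 e := MvPolynomial.isWeightedHomogeneous_zero ℂ _ e

theorem homog_C (c : ℂ) : Homog (C c) 0 := MvPolynomial.isWeightedHomogeneous_C _ c

end DiffPoly

/-! ### Derivations on power series, and the curve expression as a quadratic form in a series. -/

section Series

variable {R A : Type*} [CommRing R] [CommRing A] [Algebra R A]

/-- A derivation acting coefficientwise on formal power series. -/
def seriesDer (d : Derivation R A A) : Derivation R A⟦X⟧ A⟦X⟧ :=
  Derivation.mk'
    { toFun := fun F => PowerSeries.mk fun n => d (coeff n F)
      map_add' := fun F G => by ext n; simp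
      map_smul' := fun c F => by ext n; simp }
    fun F G => by
      ext n
      simp only [LinearMap.coe_mk, AddHom.coe_mk, PowerSeries.coeff_mk, smul_eq_mul, map_add,
        PowerSeries.coeff_mul, map_sum, Derivation.leibniz]
      rw [← Finset.Nat.sum_antidiagonal_swap (f := fun p => coeff p.1 G * d (coeff p.2 F)),
        ← Finset.sum_add_distrib]
      rfl

@[simp] theorem coeff_seriesDer (d : Derivation R A A) (F : A⟦X⟧) (n : ℕ) :
    coeff n (seriesDer d F) = d (coeff n F) := by
  change coeff n (PowerSeries.mk fun n => d (coeff n F)) = _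
  rw [PowerSeries.coeff_mk]

@[simp] theorem seriesDer_X (d : Derivation R A A) : seriesDer d PowerSeries.X = 0 := by
  ext n; simp [PowerSeries.coeff_X, apply_ite d]

@[simp] theorem seriesDer_C (d : Derivation R A A) (a : A) :
    seriesDer d (PowerSeries.C a) = PowerSeries.C (d a) := by
  ext n; simp [PowerSeries.coeff_C, apply_ite d]

theorem seriesDer_map_algebraMap (d : Derivation R A A) (c : R⟦X⟧) :
    seriesDer d (PowerSeries.map (algebraMap R A) c) = 0 := by
  ext n; simp

theorem seriesDer_ofNat (d : Derivation R A A) (n : ℕ) :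
    seriesDer d (n : A⟦X⟧) = 0 := (seriesDer d).map_natCast n

theorem coeff_seriesDer_congr (d : Derivation R A A) {F G : A⟦X⟧} {m : ℕ}
    (h : ∀ i < m, coeff i F = coeff i G) :
    ∀ i < m, coeff i (seriesDer d F) = coeff i (seriesDer d G) := fun i hi => by
  rw [coeff_seriesDer, coeff_seriesDer, h i hi]

/-- The series `ξ (F₁² - 2 F F₂) + 4 (1 + u ξ) F²`. -/
def curveSeries (u : A) (F F₁ F₂ : A⟦X⟧) : A⟦X⟧ :=
  PowerSeries.X * (F₁ ^ 2 - 2 * F₂ * F) + 4 * (1 + PowerSeries.C u * PowerSeries.X) * F ^ 2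

theorem coe_curveExpr (u : A) (w w₁ w₂ : Polynomial A) :
    ((curveExpr u w w₁ w₂ : Polynomial A) : A⟦X⟧)
      = curveSeries u (2 - (w : A⟦X⟧)) (-(w₁ : A⟦X⟧)) (-(w₂ : A⟦X⟧)) := by
  have h2 : ((2 : Polynomial A) : A⟦X⟧) = 2 := map_ofNat Polynomial.coeToPowerSeries.ringHom 2
  have h4 : ((4 : Polynomial A) : A⟦X⟧) = 4 := map_ofNat Polynomial.coeToPowerSeries.ringHom 4
  simp only [curveExpr, curveSeries, Polynomial.coe_add, Polynomial.coe_mul, Polynomial.coe_pow,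
    Polynomial.coe_sub, Polynomial.coe_X, Polynomial.coe_C, Polynomial.coe_one, h2, h4]
  ring

theorem map_curveSeries {B : Type*} [CommRing B] (φ : A →+* B) (u : A) (F F₁ F₂ : A⟦X⟧) :
    PowerSeries.map φ (curveSeries u F F₁ F₂)
      = curveSeries (φ u) (PowerSeries.map φ F) (PowerSeries.map φ F₁) (PowerSeries.map φ F₂) := by
  simp [curveSeries, map_ofNat (PowerSeries.map φ)]

theorem coeff_zero_curveSeries (u : A) (F F₁ F₂ : A⟦X⟧) :
    coeff 0 (curveSeries u F F₁ F₂) = 4 * coeff 0 F ^ 2 := by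
  simp [curveSeries, map_ofNat (PowerSeries.constantCoeff (R := A))]

theorem exists_eq_add_X_pow_mul {F G : A⟦X⟧} {m : ℕ} (h : ∀ i < m, coeff i F = coeff i G) :
    ∃ Q : A⟦X⟧, F = G + PowerSeries.X ^ m * Q := by
  obtain ⟨Q, hQ⟩ := (PowerSeries.X_pow_dvd_iff (n := m) (φ := F - G)).2 fun i hi => by
    rw [map_sub, h i hi, sub_self]
  exact ⟨Q, by rw [← hQ]; ring⟩

/-- The derivative terms carry a factor ξ, so order m is reached only through 4F². With F = G + ξᵐQ
the quadratic remainder starts at ξ²ᵐ, which is negligible because m ≠ 0. -/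
theorem coeff_curveSeries_sub (u : A) {F F₁ F₂ G G₁ G₂ : A⟦X⟧} {m : ℕ} (hm : m ≠ 0)
    (h : ∀ i < m, coeff i F = coeff i G) (h₁ : ∀ i < m, coeff i F₁ = coeff i G₁)
    (h₂ : ∀ i < m, coeff i F₂ = coeff i G₂) :
    coeff m (curveSeries u F F₁ F₂) - coeff m (curveSeries u G G₁ G₂)
      = 8 * coeff 0 G * (coeff m F - coeff m G) := by
  obtain ⟨Q, rfl⟩ := exists_eq_add_X_pow_mul h
  obtain ⟨Q₁, rfl⟩ := exists_eq_add_X_pow_mul h₁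
  obtain ⟨Q₂, rfl⟩ := exists_eq_add_X_pow_mul h₂
  have key : curveSeries u (G + PowerSeries.X ^ m * Q) (G₁ + PowerSeries.X ^ m * Q₁)
      (G₂ + PowerSeries.X ^ m * Q₂) = curveSeries u G G₁ G₂ + PowerSeries.X ^ m *
        (PowerSeries.X * (2 * G₁ * Q₁ + PowerSeries.X ^ m * Q₁ ^ 2
            - 2 * (G₂ * Q + Q₂ * G + PowerSeries.X ^ m * Q₂ * Q))
          + 4 * (1 + PowerSeries.C u * PowerSeries.X)
            * (2 * G * Q + PowerSeries.X ^ m * Q ^ 2)) := by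
    simp only [curveSeries]; ring
  have hX (P : A⟦X⟧) : coeff m (PowerSeries.X ^ m * P) = coeff 0 P := by
    simpa using PowerSeries.coeff_X_pow_mul P m 0
  rw [key, map_add, map_add, hX, hX]
  simp [hm, map_ofNat (PowerSeries.constantCoeff (R := A))]
  ring

theorem coeff_curveSeries_congr (u : A) {F F₁ F₂ G G₁ G₂ : A⟦X⟧} {m : ℕ}
    (h : ∀ i < m + 1, coeff i F = coeff i G) (h₁ : ∀ i < m, coeff i F₁ = coeff i G₁)
    (h₂ : ∀ i < m, coeff i F₂ = coeff i G₂) :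
    coeff m (curveSeries u F F₁ F₂) = coeff m (curveSeries u G G₁ G₂) := by
  rcases Nat.eq_zero_or_pos m with rfl | hm
  · rw [coeff_zero_curveSeries, coeff_zero_curveSeries, h 0 (by omega)]
  · have := coeff_curveSeries_sub u hm.ne' (fun i hi => h i (by omega)) h₁ h₂
    rwa [h m (by omega), sub_self, mul_zero, sub_eq_zero] at this

theorem coeff_genFun (g : ℕ) (w : ℕ → A) (k : ℕ) :
    (genFun g w).coeff k = if 1 ≤ k ∧ k ≤ g then w k else 0 := by
  simp [genFun, Polynomial.coeff_C_mul, Polynomial.coeff_X_pow]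

theorem genFun_congr {g : ℕ} {w w' : ℕ → A} (h : ∀ i ∈ Finset.Icc 1 g, w i = w' i) :
    genFun g w = genFun g w' :=
  Finset.sum_congr rfl fun i hi => by rw [h i hi]

end Series

/-! ### The generating series of the Θ_k, the Lenard recursion and the scaling by constant series.
-/

namespace DiffPoly

open MvPolynomial (constantCoeff)

local notation "∂ₛ" => seriesDer D

/-- The expression `ξ (F'² - 2 F F'') + 4 (1 + u ξ) F²` in a series of differential polynomials. -/
def curveForm (F : DiffPoly⟦X⟧) : DiffPoly⟦X⟧ :=
  curveSeries (MvPolynomial.X 0) F (∂ₛ F) (∂ₛ (∂ₛ F))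

/-- The operator `-ξ ∂³ + 4 (1 + u ξ) ∂ + 2 u' ξ`. -/
def lenard (F : DiffPoly⟦X⟧) : DiffPoly⟦X⟧ :=
  -PowerSeries.X * ∂ₛ (∂ₛ (∂ₛ F))
    + 4 * (1 + PowerSeries.C (MvPolynomial.X 0) * PowerSeries.X) * ∂ₛ F
    + 2 * (PowerSeries.C (MvPolynomial.X 1) * PowerSeries.X) * F

/-- `curveForm` is a first integral of the third-order equation `lenard F = 0`, the equation
satisfied by products of two solutions of ψ'' = (u + ξ⁻¹)ψ. -/
theorem seriesDer_curveForm (F : DiffPoly⟦X⟧) : ∂ₛ (curveForm F) = 2 * F * lenard F := by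
  have h2 : ∂ₛ (2 : DiffPoly⟦X⟧) = 0 := seriesDer_ofNat D 2
  have h4 : ∂ₛ (4 : DiffPoly⟦X⟧) = 0 := seriesDer_ofNat D 4
  simp only [curveForm, curveSeries, lenard, Derivation.leibniz, Derivation.leibniz_pow, map_add,
    map_sub, seriesDer_X, seriesDer_C, D_X, smul_eq_mul, h2, h4, Derivation.map_one_eq_zero]
  simp only [nsmul_eq_mul]
  push_cast
  ring

theorem coeff_zero_lenard (F : DiffPoly⟦X⟧) : coeff 0 (lenard F) = 4 * D (coeff 0 F) := by
  rw [← coeff_seriesDer, lenard]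
  simp only [PowerSeries.coeff_zero_eq_constantCoeff_apply, map_add, map_mul, map_neg, map_one,
    PowerSeries.constantCoeff_X, PowerSeries.constantCoeff_C,
    map_ofNat (PowerSeries.constantCoeff (R := DiffPoly))]
  ring

theorem coeff_succ_lenard (F : DiffPoly⟦X⟧) (k : ℕ) :
    coeff (k + 1) (lenard F) = 4 * D (coeff (k + 1) F) - D (D (D (coeff k F)))
      + 4 * MvPolynomial.X 0 * D (coeff k F) + 2 * MvPolynomial.X 1 * coeff k F := by
  have h : lenard F = PowerSeries.X * (-∂ₛ (∂ₛ (∂ₛ F))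
      + PowerSeries.C (4 * MvPolynomial.X 0) * ∂ₛ F + PowerSeries.C (2 * MvPolynomial.X 1) * F)
      + PowerSeries.C 4 * ∂ₛ F := by
    simp only [lenard, map_mul, map_ofNat]; ring
  rw [h, map_add, PowerSeries.coeff_succ_X_mul]
  simp only [map_add, map_neg, PowerSeries.coeff_C_mul, coeff_seriesDer]
  ring

theorem lenard_eq_zero_of_seriesDer_curveForm {F : DiffPoly⟦X⟧} (h0 : coeff 0 F = 2)
    (h : ∂ₛ (curveForm F) = 0) : lenard F = 0 := by
  rw [seriesDer_curveForm] at h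
  have hF : (2 : DiffPoly⟦X⟧) * F ≠ 0 := by
    intro h1
    have h2 := congrArg (coeff 0) h1
    rw [← map_ofNat (PowerSeries.C (R := DiffPoly)), PowerSeries.coeff_C_mul, h0, map_zero] at h2
    norm_num at h2
  exact (mul_eq_zero.1 h).resolve_left hF

theorem eq_of_curveForm_eq {F G : DiffPoly⟦X⟧} (hF : coeff 0 F = 2) (hG : coeff 0 G = 2)
    (h : curveForm F = curveForm G) : F = G := by
  ext1 m
  induction m using Nat.strong_induction_on with
  | _ m ih =>
    rcases Nat.eq_zero_or_pos m with rfl | hm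
    · rw [hF, hG]
    · have h1 := coeff_seriesDer_congr D ih
      have h2 := coeff_curveSeries_sub (MvPolynomial.X 0) hm.ne' ih h1 (coeff_seriesDer_congr D h1)
      change coeff m (curveForm F) - coeff m (curveForm G) = _ at h2
      rw [h, sub_self, hG] at h2
      have := (mul_eq_zero.1 h2.symm).resolve_left (by norm_num)
      exact sub_eq_zero.1 this

/-- Formal power series with constant coefficients, as series of differential polynomials. -/
abbrev constSeries : ℂ⟦X⟧ →+* DiffPoly⟦X⟧ := PowerSeries.map (algebraMap ℂ DiffPoly)

theorem curveForm_constSeries_mul (c : ℂ⟦X⟧) (F : DiffPoly⟦X⟧) :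
    curveForm (constSeries c * F) = constSeries (c ^ 2) * curveForm F := by
  have h : ∀ G, ∂ₛ (constSeries c * G) = constSeries c * ∂ₛ G := fun G => by
    rw [Derivation.leibniz, seriesDer_map_algebraMap, smul_zero, add_zero, smul_eq_mul]
  rw [curveForm, h, h, curveForm, curveSeries, curveSeries, map_pow]
  ring

/-- The generating series `2 - ∑ Θ_k ξᵏ`. -/
def thetaSeries (μ : ℕ → ℂ) : DiffPoly⟦X⟧ :=
  PowerSeries.mk fun k => if k = 0 then 2 else -Theta μ k

/-- The series `4 (4 + ∑ μ_k ξᵏ⁺¹)`. -/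
def curveConst (μ : ℕ → ℂ) : ℂ⟦X⟧ :=
  PowerSeries.mk fun k => if k = 0 then 16 else if k = 1 then 0 else 4 * μ (k - 1)

@[simp] theorem coeff_zero_thetaSeries (μ : ℕ → ℂ) : coeff 0 (thetaSeries μ) = 2 := by
  simp [thetaSeries, -PowerSeries.coeff_zero_eq_constantCoeff]

theorem coeff_thetaSeries (μ : ℕ → ℂ) {k : ℕ} (hk : k ≠ 0) :
    coeff k (thetaSeries μ) = -Theta μ k := by
  simp [thetaSeries, hk]

theorem coe_genFun_D (g : ℕ) (w : ℕ → DiffPoly) :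
    ((genFun g fun i => D (w i) : Polynomial DiffPoly) : DiffPoly⟦X⟧)
      = ∂ₛ (genFun g w : Polynomial DiffPoly) := by
  ext1 k
  rw [coeff_seriesDer, Polynomial.coeff_coe, Polynomial.coeff_coe, coeff_genFun, coeff_genFun]
  split_ifs <;> simp

theorem curveCoeff_eq (g : ℕ) (w : ℕ → DiffPoly) (k : ℕ) :
    curveCoeff g w k = coeff (k + 1) (curveForm (2 - (genFun g w : Polynomial DiffPoly))) := by
  have h2 : ∂ₛ (2 : DiffPoly⟦X⟧) = 0 := seriesDer_ofNat D 2
  rw [curveCoeff, ← Polynomial.coeff_coe, coe_curveExpr, coe_genFun_D, coe_genFun_D, coe_genFun_D,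
    curveForm, map_sub, h2, zero_sub, map_neg]

theorem coeff_two_sub_genFun_Theta (μ : ℕ → ℂ) {g k : ℕ} (hk : k ≤ g) :
    coeff k (2 - (genFun g (Theta μ) : Polynomial DiffPoly) : DiffPoly⟦X⟧)
      = coeff k (thetaSeries μ) := by
  have h2 : (2 : DiffPoly⟦X⟧) = PowerSeries.C 2 := by rw [map_ofNat]
  rw [map_sub, Polynomial.coeff_coe, coeff_genFun, h2, PowerSeries.coeff_C]
  rcases Nat.eq_zero_or_pos k with rfl | h
  · simp only [coeff_zero_thetaSeries]; simp
  · rw [coeff_thetaSeries μ h.ne', if_neg h.ne', if_pos ⟨h, hk⟩, zero_sub]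

theorem coeff_curveForm_congr {F G : DiffPoly⟦X⟧} {m : ℕ}
    (h : ∀ i < m + 1, coeff i F = coeff i G) :
    coeff m (curveForm F) = coeff m (curveForm G) := by
  have h1 := coeff_seriesDer_congr D h
  have h2 := coeff_seriesDer_congr D h1
  exact coeff_curveSeries_congr _ h (fun i hi => h1 i (by omega)) fun i hi => h2 i (by omega)

theorem coeff_curveForm_sub {F G : DiffPoly⟦X⟧} {m : ℕ} (hm : m ≠ 0)
    (h : ∀ i < m, coeff i F = coeff i G) :
    coeff m (curveForm F) - coeff m (curveForm G)
      = 8 * coeff 0 G * (coeff m F - coeff m G) :=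
  coeff_curveSeries_sub _ hm h (coeff_seriesDer_congr D h)
    (coeff_seriesDer_congr D (coeff_seriesDer_congr D h))

/-- The recursion defining `Theta` is this identity read coefficient by coefficient. -/
theorem curveForm_thetaSeries (μ : ℕ → ℂ) :
    curveForm (thetaSeries μ) = constSeries (curveConst μ) := by
  ext1 m
  rw [PowerSeries.coeff_map, curveConst, PowerSeries.coeff_mk]
  match m with
  | 0 =>
    rw [curveForm, coeff_zero_curveSeries, coeff_zero_thetaSeries, if_pos rfl, map_ofNat]
    norm_num
  | 1 =>
    -- The constant series 2 contributes 16u at order one, cancelled by -16Θ_1. This is why μ(ξ) has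
    -- no term at ξ⁰.
    have h := coeff_curveForm_sub (F := thetaSeries μ) (G := PowerSeries.C 2) one_ne_zero
      (fun i hi => by obtain rfl : i = 0 := by omega
                      rw [coeff_zero_thetaSeries, PowerSeries.coeff_zero_C])
    rw [coeff_thetaSeries μ one_ne_zero] at h
    have h2 : D (2 : DiffPoly) = 0 := by simpa using D.map_natCast 2
    have h3 : coeff 1 (curveForm (PowerSeries.C 2)) = 16 * MvPolynomial.X 0 := by
      rw [curveForm, seriesDer_C, h2, map_zero, map_zero, curveSeries]
      have : PowerSeries.X * ((0 : DiffPoly⟦X⟧) ^ 2 - 2 * 0 * PowerSeries.C 2)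
        + 4 * (1 + PowerSeries.C (MvPolynomial.X 0) * PowerSeries.X) * PowerSeries.C 2 ^ 2
        = PowerSeries.C 16 + PowerSeries.C (16 * MvPolynomial.X 0) * PowerSeries.X := by
        simp only [map_mul, map_ofNat]; ring
      rw [this]
      simp [PowerSeries.coeff_C]
    rw [h3, PowerSeries.coeff_zero_C, PowerSeries.coeff_C, Theta, if_neg one_ne_zero] at h
    simp only [one_ne_zero, if_false, if_true, map_zero]
    linear_combination h
  | k + 2 =>
    -- The recursion uses the sum cut off at k + 1; its coefficient at ξᵏ⁺² is zero, so the
    -- comparison isolates -16Θ_{k+2}.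
    have h := coeff_curveForm_sub (F := thetaSeries μ)
      (G := 2 - (genFun (k + 1) (Theta μ) : Polynomial DiffPoly)) (Nat.succ_ne_zero (k + 1))
      (fun i hi => (coeff_two_sub_genFun_Theta μ (by omega)).symm)
    have h0 : coeff (k + 2) (2 - (genFun (k + 1) (Theta μ) : Polynomial DiffPoly) : DiffPoly⟦X⟧)
        = 0 := by
      have h2 : (2 : DiffPoly⟦X⟧) = PowerSeries.C 2 := by rw [map_ofNat]
      rw [map_sub, Polynomial.coeff_coe, coeff_genFun, h2, PowerSeries.coeff_C]
      simp
    rw [coeff_two_sub_genFun_Theta μ (Nat.zero_le _), coeff_zero_thetaSeries, h0,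
      coeff_thetaSeries μ (Nat.succ_ne_zero _), ← curveCoeff_eq, Theta] at h
    have hc : curveCoeff (k + 1) (fun i => if _h : i < k + 2 then Theta μ i else 0) (k + 1)
        = curveCoeff (k + 1) (Theta μ) (k + 1) := by
      rw [curveCoeff_eq, curveCoeff_eq, genFun_congr fun i hi => ?_]
      rw [dif_pos (by have := Finset.mem_Icc.1 hi; omega)]
    rw [hc] at h
    have h16 : (16 : DiffPoly) * MvPolynomial.C (1 / 16) = 1 := by
      rw [← map_ofNat (MvPolynomial.C (σ := ℕ) (R := ℂ)), ← map_mul]; norm_num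
    simp only [Nat.succ_ne_zero, if_false, show k + 2 ≠ 1 by omega]
    rw [MvPolynomial.algebraMap_eq, show k + 2 - 1 = k + 1 by omega]
    linear_combination h - (curveCoeff (k + 1) (Theta μ) (k + 1) - MvPolynomial.C (4 * μ (k + 1)))
      * h16

theorem seriesDer_curveForm_thetaSeries (μ : ℕ → ℂ) : ∂ₛ (curveForm (thetaSeries μ)) = 0 := by
  rw [curveForm_thetaSeries, seriesDer_map_algebraMap]

theorem lenard_thetaSeries (μ : ℕ → ℂ) : lenard (thetaSeries μ) = 0 :=
  lenard_eq_zero_of_seriesDer_curveForm (coeff_zero_thetaSeries μ)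
    (seriesDer_curveForm_thetaSeries μ)

theorem lenard_constSeries_mul (c : ℂ⟦X⟧) (F : DiffPoly⟦X⟧) :
    lenard (constSeries c * F) = constSeries c * lenard F := by
  have h : ∀ G, ∂ₛ (constSeries c * G) = constSeries c * ∂ₛ G := fun G => by
    rw [Derivation.leibniz, seriesDer_map_algebraMap, smul_zero, add_zero, smul_eq_mul]
  rw [lenard, h, h, h, lenard]
  ring

/-- The square root of `1 + ∑ μ_k ξᵏ⁺¹ / 4`. -/
def rootSeries (μ : ℕ → ℂ) : ℂ⟦X⟧ :=
  PowerSeries.C (1 / 2) * PowerSeries.map constantCoeff (thetaSeries μ)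

/-- Taking constant terms kills u and all derivatives, which reduces `curveForm F` to 4F². The
square root thus comes from the constant terms of the Θ_k. -/
theorem curveConst_eq (μ : ℕ → ℂ) : curveConst μ = 16 * rootSeries μ ^ 2 := by
  have h := congrArg (PowerSeries.map constantCoeff) (curveForm_thetaSeries μ)
  have h1 : PowerSeries.map constantCoeff (constSeries (curveConst μ)) = curveConst μ := by
    ext n; simp
  have h2 : ∀ F : DiffPoly⟦X⟧, PowerSeries.map constantCoeff (∂ₛ F) = 0 := fun F => by
    ext n; simp
  rw [h1, curveForm, map_curveSeries, h2, h2, curveSeries, MvPolynomial.constantCoeff_X] at h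
  rw [← h, rootSeries, mul_pow, ← map_pow PowerSeries.C]
  have : (16 : ℂ⟦X⟧) * PowerSeries.C ((1 / 2) ^ 2) = 4 := by
    rw [← map_ofNat (PowerSeries.C (R := ℂ)), ← map_mul,
      ← map_ofNat (PowerSeries.C (R := ℂ))]; norm_num
  rw [← mul_assoc, this, map_zero]
  ring

theorem curveConst_zero : curveConst 0 = 16 := by
  have : (16 : ℂ⟦X⟧) = PowerSeries.C 16 := by rw [map_ofNat]
  ext k
  rw [this, curveConst, PowerSeries.coeff_mk, PowerSeries.coeff_C]
  simp

theorem coeff_zero_rootSeries (μ : ℕ → ℂ) : coeff 0 (rootSeries μ) = 1 := by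
  rw [rootSeries, PowerSeries.coeff_C_mul, PowerSeries.coeff_map, coeff_zero_thetaSeries,
    map_ofNat]
  norm_num

theorem coeff_one_rootSeries (μ : ℕ → ℂ) : coeff 1 (rootSeries μ) = 0 := by
  rw [rootSeries, PowerSeries.coeff_C_mul, PowerSeries.coeff_map,
    coeff_thetaSeries μ one_ne_zero, Theta]
  simp

/-- Both sides start with 2 and have the same `curveForm`, since a constant factor acts on it by its
square. -/
theorem thetaSeries_eq (μ : ℕ → ℂ) :
    thetaSeries μ = constSeries (rootSeries μ) * thetaSeries 0 := by
  refine eq_of_curveForm_eq (coeff_zero_thetaSeries μ) ?_ ?_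
  · rw [PowerSeries.coeff_mul, Finset.Nat.antidiagonal_zero,
      Finset.sum_singleton, coeff_zero_thetaSeries, PowerSeries.coeff_map,
      coeff_zero_rootSeries, map_one, one_mul]
  · rw [curveForm_constSeries_mul, curveForm_thetaSeries, curveForm_thetaSeries, curveConst_zero,
      curveConst_eq, map_mul, mul_comm]

theorem D_Theta_succ (μ : ℕ → ℂ) (k : ℕ) :
    D (Theta μ (k + 1)) = ∑ i ∈ Finset.range (k + 1),
      MvPolynomial.C (coeff i (rootSeries μ)) * D (Theta 0 (k + 1 - i)) := by
  have h := congrArg (coeff (k + 1)) (congrArg ∂ₛ (thetaSeries_eq μ))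
  rw [Derivation.leibniz, seriesDer_map_algebraMap, smul_zero, add_zero, smul_eq_mul,
    coeff_seriesDer, coeff_thetaSeries μ (Nat.succ_ne_zero k), map_neg, PowerSeries.coeff_mul,
    Finset.Nat.sum_antidiagonal_eq_sum_range_succ
      (fun i j => coeff i (constSeries (rootSeries μ)) * coeff j (∂ₛ (thetaSeries 0))),
    Finset.sum_range_succ, Nat.sub_self, coeff_seriesDer, coeff_zero_thetaSeries] at h
  have h2 : D (2 : DiffPoly) = 0 := by simpa using D.map_natCast 2
  rw [h2, mul_zero, add_zero, neg_eq_iff_eq_neg, ← Finset.sum_neg_distrib] at h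
  rw [h]
  refine Finset.sum_congr rfl fun i hi => ?_
  rw [coeff_seriesDer, coeff_thetaSeries 0 (by have := Finset.mem_range.1 hi; omega),
    PowerSeries.coeff_map, MvPolynomial.algebraMap_eq, map_neg]
  ring

end DiffPoly

namespace DiffPoly

open MvPolynomial (constantCoeff)

/-! ### Differential operators -/

@[simp] theorem dx_apply (f : DiffPoly) : dx f = D f := rfl

@[simp] theorem mulOp_apply (f g : DiffPoly) : mulOp f g = f * g := rfl

theorem diffOp_add (p q : Polynomial DiffPoly) : diffOp (p + q) = diffOp p + diffOp q :=
  Polynomial.sum_add_index p q _ (fun i => LinearMap.ext fun f => by simp)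
    fun i c d => LinearMap.ext fun f => by simp [add_mul]

theorem diffOpAdj_add (p q : Polynomial DiffPoly) :
    diffOpAdj (p + q) = diffOpAdj p + diffOpAdj q :=
  Polynomial.sum_add_index p q _
    (fun i => LinearMap.ext fun f => by simp) fun i c d => LinearMap.ext fun f => by simp [add_mul]

theorem diffOp_monomial (i : ℕ) (c : DiffPoly) :
    diffOp (Polynomial.monomial i c) = mulOp c * dx ^ i :=
  Polynomial.sum_monomial_index c _ (LinearMap.ext fun f => by simp)

theorem diffOpAdj_monomial (i : ℕ) (c : DiffPoly) :
    diffOpAdj (Polynomial.monomial i c) = (-dx) ^ i * mulOp c :=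
  Polynomial.sum_monomial_index c _ (LinearMap.ext fun f => by simp)

theorem dx_mul_mulOp (f : DiffPoly) : dx * mulOp f = mulOp f * dx + mulOp (D f) := by
  refine LinearMap.ext fun g => ?_
  simp [Derivation.leibniz, mul_comm]

theorem end_neg_mul (S T : Module.End ℂ DiffPoly) : -S * T = -(S * T) := rfl

theorem end_mul_neg (S T : Module.End ℂ DiffPoly) : S * -T = -(S * T) :=
  LinearMap.ext fun f => map_neg S (T f)

theorem mulOp_mul (f g : DiffPoly) : mulOp (f * g) = mulOp f * mulOp g := by
  refine LinearMap.ext fun h => ?_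
  simp [mul_assoc]

theorem diffOp_C_mul (f : DiffPoly) (p : Polynomial DiffPoly) :
    diffOp (Polynomial.C f * p) = mulOp f * diffOp p := by
  induction p using Polynomial.induction_on' with
  | add p q hp hq => rw [mul_add, diffOp_add, diffOp_add, hp, hq, mul_add]
  | monomial n a =>
    rw [Polynomial.C_mul_monomial, diffOp_monomial, diffOp_monomial, mulOp_mul, mul_assoc]

theorem diffOpAdj_C_mul (f : DiffPoly) (p : Polynomial DiffPoly) :
    diffOpAdj (Polynomial.C f * p) = diffOpAdj p * mulOp f := by
  induction p using Polynomial.induction_on' with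
  | add p q hp hq => rw [mul_add, diffOpAdj_add, diffOpAdj_add, hp, hq, add_mul]
  | monomial n a =>
    rw [Polynomial.C_mul_monomial, diffOpAdj_monomial, diffOpAdj_monomial, mul_comm f, mulOp_mul,
      mul_assoc]

/-- The coefficients of the operator `∂ₓ ∘ diffOp p`. -/
def dxMul (p : Polynomial DiffPoly) : Polynomial DiffPoly :=
  Polynomial.X * p + p.sum fun i c => Polynomial.monomial i (D c)

theorem coeff_sum_monomial_D (p : Polynomial DiffPoly) (i : ℕ) :
    (p.sum fun i c => Polynomial.monomial i (D c)).coeff i = D (p.coeff i) := by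
  rw [Polynomial.sum_def, Polynomial.finsetSum_coeff]
  simp only [Polynomial.coeff_monomial, Finset.sum_ite_eq', Polynomial.mem_support_iff]
  split_ifs with h
  · rfl
  · rw [not_not.1 h, map_zero]

theorem coeff_dxMul_zero (p : Polynomial DiffPoly) : (dxMul p).coeff 0 = D (p.coeff 0) := by
  rw [dxMul, Polynomial.coeff_add, coeff_sum_monomial_D, Polynomial.coeff_X_mul_zero, zero_add]

theorem coeff_dxMul_succ (p : Polynomial DiffPoly) (i : ℕ) :
    (dxMul p).coeff (i + 1) = p.coeff i + D (p.coeff (i + 1)) := by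
  rw [dxMul, Polynomial.coeff_add, coeff_sum_monomial_D, Polynomial.coeff_X_mul]

theorem dxMul_add (p q : Polynomial DiffPoly) : dxMul (p + q) = dxMul p + dxMul q := by
  ext1 i
  rw [Polynomial.coeff_add]
  rcases i with _ | i
  · simp only [coeff_dxMul_zero, Polynomial.coeff_add, map_add]
  · simp only [coeff_dxMul_succ, Polynomial.coeff_add, map_add]; ring

theorem dxMul_monomial (n : ℕ) (a : DiffPoly) : dxMul (Polynomial.monomial n a)
    = Polynomial.monomial (n + 1) a + Polynomial.monomial n (D a) := by
  rw [dxMul, Polynomial.X_mul_monomial, Polynomial.sum_monomial_index _ _ (by simp)]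

theorem diffOp_dxMul (p : Polynomial DiffPoly) : diffOp (dxMul p) = dx * diffOp p := by
  induction p using Polynomial.induction_on' with
  | add p q hp hq => rw [dxMul_add, diffOp_add, diffOp_add, hp, hq, mul_add]
  | monomial n a =>
    rw [dxMul_monomial, diffOp_add, diffOp_monomial, diffOp_monomial, diffOp_monomial, ← mul_assoc,
      dx_mul_mulOp, pow_succ', add_mul, mul_assoc]

theorem diffOpAdj_dxMul (p : Polynomial DiffPoly) : diffOpAdj (dxMul p) = -(diffOpAdj p * dx) := by
  induction p using Polynomial.induction_on' with
  | add p q hp hq => rw [dxMul_add, diffOpAdj_add, diffOpAdj_add, hp, hq, add_mul, neg_add]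
  | monomial n a =>
    rw [dxMul_monomial, diffOpAdj_add, diffOpAdj_monomial, diffOpAdj_monomial, diffOpAdj_monomial,
      pow_succ, mul_assoc ((-dx) ^ n), end_neg_mul, dx_mul_mulOp, end_mul_neg,
      mul_add, mul_assoc, neg_add, neg_add_cancel_right]

theorem diffOp_apply (p : Polynomial DiffPoly) (f : DiffPoly) :
    diffOp p f = ∑ i ∈ Finset.range (p.natDegree + 1), p.coeff i * D^[i] f := by
  rw [diffOp, Polynomial.sum_over_range _ fun i => LinearMap.ext fun f => by simp,
    LinearMap.sum_apply]
  refine Finset.sum_congr rfl fun i _ => ?_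
  rw [Module.End.mul_apply, Module.End.pow_apply]
  rfl

/-- The operator `∑ pᵢ ∂ₓⁱ` is homogeneous of degree `d`. -/
structure OpHomog (p : Polynomial DiffPoly) (d : ℕ) : Prop where
  homog : ∀ i ≤ d, Homog (p.coeff i) (d - i)
  eq_zero : ∀ i > d, p.coeff i = 0

theorem OpHomog.add {p q : Polynomial DiffPoly} {d : ℕ} (hp : OpHomog p d) (hq : OpHomog q d) :
    OpHomog (p + q) d where
  homog i hi := by rw [Polynomial.coeff_add]; exact (hp.homog i hi).add (hq.homog i hi)
  eq_zero i hi := by rw [Polynomial.coeff_add, hp.eq_zero i hi, hq.eq_zero i hi, add_zero]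

theorem OpHomog.C_mul {p : Polynomial DiffPoly} {d e : ℕ} {f : DiffPoly} (hp : OpHomog p d)
    (hf : Homog f e) : OpHomog (Polynomial.C f * p) (d + e) where
  homog i hi := by
    rw [Polynomial.coeff_C_mul]
    by_cases h : i ≤ d
    · convert hf.mul (hp.homog i h) using 1; omega
    · rw [hp.eq_zero i (by omega), mul_zero]; exact homog_zero _
  eq_zero i hi := by rw [Polynomial.coeff_C_mul, hp.eq_zero i (by omega), mul_zero]

theorem OpHomog.dxMul {p : Polynomial DiffPoly} {d : ℕ} (hp : OpHomog p d) :
    OpHomog (DiffPoly.dxMul p) (d + 1) where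
  homog i hi := by
    match i with
    | 0 => rw [coeff_dxMul_zero]; exact (hp.homog 0 (Nat.zero_le _)).D
    | i + 1 =>
      rw [coeff_dxMul_succ]
      have h1 : Homog (p.coeff i) (d + 1 - (i + 1)) := by
        convert hp.homog i (by omega) using 1; omega
      refine h1.add ?_
      by_cases h : i + 1 ≤ d
      · convert (hp.homog _ h).D using 1; omega
      · rw [hp.eq_zero _ (by omega), map_zero]; exact homog_zero _
  eq_zero i hi := by
    obtain ⟨i, rfl⟩ : ∃ j, i = j + 1 := ⟨i - 1, by omega⟩
    rw [coeff_dxMul_succ, hp.eq_zero _ (by omega), hp.eq_zero _ (by omega), map_zero, add_zero]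

/-- A homogeneous differential operator of degree `d` with `c` as the coefficient at `∂ₓᵈ`, and its
formal conjugate. -/
def HomogOp (d : ℕ) (c : ℂ) (S T : Module.End ℂ DiffPoly) : Prop :=
  ∃ p, OpHomog p d ∧ p.coeff d = MvPolynomial.C c ∧ diffOp p = S ∧ diffOpAdj p = T

namespace HomogOp

variable {d : ℕ} {c c' : ℂ} {S T S' T' : Module.End ℂ DiffPoly}

theorem zero (d : ℕ) : HomogOp d 0 0 0 :=
  ⟨0, ⟨fun _ _ => by rw [Polynomial.coeff_zero]; exact homog_zero _, fun _ _ => rfl⟩, by simp,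
    Polynomial.sum_zero_index _, Polynomial.sum_zero_index _⟩

theorem one : HomogOp 0 1 1 1 := by
  have h1 : mulOp 1 = 1 := LinearMap.ext fun f => by simp
  refine ⟨Polynomial.monomial 0 1, ⟨fun i hi => ?_, fun i hi => ?_⟩, by simp, ?_, ?_⟩
  · obtain rfl : i = 0 := by omega
    simpa using homog_C 1
  · rw [Polynomial.coeff_monomial, if_neg (by omega)]
  · rw [diffOp_monomial, h1, pow_zero, mul_one]
  · rw [diffOpAdj_monomial, h1, pow_zero, mul_one]

theorem add (h : HomogOp d c S T) (h' : HomogOp d c' S' T') :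
    HomogOp d (c + c') (S + S') (T + T') := by
  obtain ⟨p, h1, h2, rfl, rfl⟩ := h
  obtain ⟨q, h3, h4, rfl, rfl⟩ := h'
  exact ⟨p + q, h1.add h3, by rw [Polynomial.coeff_add, h2, h4, map_add], diffOp_add p q,
    diffOpAdj_add p q⟩

theorem mulOp_mul {e : ℕ} {f : DiffPoly} (hf : Homog f e) (h : HomogOp d c S T) :
    HomogOp (d + e) (constantCoeff f * c) (mulOp f * S) (T * mulOp f) := by
  obtain ⟨p, h1, h2, rfl, rfl⟩ := h
  refine ⟨Polynomial.C f * p, h1.C_mul hf, ?_, diffOp_C_mul f p, diffOpAdj_C_mul f p⟩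
  rw [Polynomial.coeff_C_mul]
  rcases Nat.eq_zero_or_pos e with rfl | he
  · rw [hf.eq_C, add_zero, h2, map_mul, MvPolynomial.constantCoeff_C]
  · rw [h1.eq_zero _ (by omega), hf.constantCoeff_eq_zero he.ne', mul_zero, zero_mul, map_zero]

theorem dx_mul (h : HomogOp d c S T) : HomogOp (d + 1) c (dx * S) (-(T * dx)) := by
  obtain ⟨p, h1, h2, rfl, rfl⟩ := h
  refine ⟨dxMul p, h1.dxMul, ?_, diffOp_dxMul p, diffOpAdj_dxMul p⟩
  rw [coeff_dxMul_succ, h2, h1.eq_zero _ (by omega), map_zero, add_zero]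

theorem neg (h : HomogOp d c S T) : HomogOp d (-c) (-S) (-T) := by
  have h1 : mulOp (MvPolynomial.C (-1)) = -1 :=
    LinearMap.ext fun f => by simp
  have h2 := h.mulOp_mul (homog_C (-1))
  rw [h1, end_neg_mul, end_mul_neg, one_mul, mul_one] at h2
  simpa using h2

theorem sub (h : HomogOp d c S T) (h' : HomogOp d c' S' T') :
    HomogOp d (c - c') (S - S') (T - T') := by
  simpa only [sub_eq_add_neg] using h.add h'.neg

theorem sum {ι : Type*} (s : Finset ι) {c : ι → ℂ} {S T : ι → Module.End ℂ DiffPoly}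
    (h : ∀ i ∈ s, HomogOp d (c i) (S i) (T i)) :
    HomogOp d (∑ i ∈ s, c i) (∑ i ∈ s, S i) (∑ i ∈ s, T i) := by
  induction s using Finset.cons_induction with
  | empty => exact zero d
  | cons i s hi ih =>
    simp only [Finset.sum_cons]
    exact (h i (by simp)).add (ih fun j hj => h j (by simp [hj]))

theorem schrodinger_mul (h : HomogOp d c S T) :
    HomogOp (d + 2) c (schrodinger * S) (T * schrodinger) := by
  have hX : Homog (MvPolynomial.X 0) 2 := MvPolynomial.isWeightedHomogeneous_X ℂ _ 0
  have h1 := HomogOp.sub (d := d + 2) h.dx_mul.dx_mul (h.mulOp_mul hX)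
  rw [MvPolynomial.constantCoeff_X, zero_mul, sub_zero] at h1
  convert h1 using 1
  · rw [schrodinger, sub_mul, pow_two, mul_assoc]
  · rw [schrodinger, mul_sub, pow_two, end_neg_mul, neg_neg, mul_assoc]

theorem schrodinger_pow_mul (h : HomogOp d c S T) (n : ℕ) :
    HomogOp (d + 2 * n) c (schrodinger ^ n * S) (T * schrodinger ^ n) := by
  induction n with
  | zero => simpa using h
  | succ n ih =>
    have h1 := ih.schrodinger_mul
    rwa [← mul_assoc, ← pow_succ', mul_assoc, ← pow_succ, add_assoc] at h1

end HomogOp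

/-- The operator `2h ∂ₓ - h'`. -/
def laxOp (h : DiffPoly) : Module.End ℂ DiffPoly := mulOp (2 * h) * dx - mulOp (D h)

/-- The formal conjugate of `2h ∂ₓ - h'`. -/
def laxOpAdj (h : DiffPoly) : Module.End ℂ DiffPoly := -(dx * mulOp (2 * h)) - mulOp (D h)

theorem homog_two_mul {h : DiffPoly} {e : ℕ} (hh : Homog h e) : Homog (2 * h) e := by
  rw [two_mul]; exact hh.add hh

theorem HomogOp.laxOp_mul {d e : ℕ} {c : ℂ} {S T : Module.End ℂ DiffPoly} {h : DiffPoly}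
    (hh : Homog h e) (hS : HomogOp d c S T) :
    HomogOp (d + 1 + e) (2 * constantCoeff h * c) (laxOp h * S) (T * laxOpAdj h) := by
  have h1 := (hS.dx_mul.mulOp_mul (homog_two_mul hh)).sub
    (by simpa only [add_comm, add_left_comm] using hS.mulOp_mul hh.D)
  convert h1 using 1
  · simp [map_ofNat (constantCoeff (R := ℂ) (σ := ℕ))]
  · rw [laxOp, sub_mul, mul_assoc]
  · rw [laxOpAdj, mul_sub, end_neg_mul, end_mul_neg, mul_assoc]

theorem HomogOp.exists_laxOpAdj {e : ℕ} {h : DiffPoly} (hh : Homog h e) :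
    ∃ T, HomogOp (e + 1) (-(2 * constantCoeff h)) (laxOpAdj h) T := by
  have h1 := (HomogOp.one.mulOp_mul (homog_two_mul hh)).dx_mul.neg.sub
    (by simpa only [add_assoc] using HomogOp.one.mulOp_mul hh.D)
  refine ⟨- -(1 * mulOp (2 * h) * dx) - 1 * mulOp (D h), ?_⟩
  convert h1 using 1
  · omega
  · simp [map_ofNat (constantCoeff (R := ℂ) (σ := ℕ))]
  · rw [laxOpAdj, mul_one, mul_one]

/-- The summand -h' is chosen to remove the first-order term of [L, 2h∂]. What is left over after
4h'L is a multiplication, and the recursion makes it the next 4h', so that sums over j telescope. -/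
theorem commutator_laxOp {h h' : DiffPoly}
    (hh : 4 * D h' = D (D (D h)) - 4 * MvPolynomial.X 0 * D h - 2 * MvPolynomial.X 1 * h) :
    schrodinger * laxOp h - laxOp h * schrodinger
      = mulOp (4 * D h) * schrodinger - mulOp (4 * D h') := by
  have h2 : D (2 : DiffPoly) = 0 := by simpa using D.map_natCast 2
  refine LinearMap.ext fun f => ?_
  simp only [schrodinger, laxOp, pow_two, LinearMap.sub_apply, Module.End.mul_apply, mulOp_apply,
    dx_apply, map_sub, map_add, Derivation.leibniz, smul_eq_mul, D_X, hh, h2]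
  ring_nf
  simp only [map_zero]
  ring

theorem commutator_laxOpAdj {h h' : DiffPoly}
    (hh : 4 * D h' = D (D (D h)) - 4 * MvPolynomial.X 0 * D h - 2 * MvPolynomial.X 1 * h) :
    schrodinger * laxOpAdj h - laxOpAdj h * schrodinger
      = mulOp (4 * D h') - schrodinger * mulOp (4 * D h) := by
  have h2 : D (2 : DiffPoly) = 0 := by simpa using D.map_natCast 2
  have h4 : D (4 : DiffPoly) = 0 := by simpa using D.map_natCast 4
  refine LinearMap.ext fun f => ?_
  simp only [schrodinger, laxOpAdj, pow_two, LinearMap.sub_apply, LinearMap.neg_apply,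
    Module.End.mul_apply, mulOp_apply, map_neg,
    dx_apply, map_sub, map_add, Derivation.leibniz, smul_eq_mul, D_X, hh, h2, h4]
  ring_nf
  simp only [map_zero]
  ring

/-- An operator whose commutator with the Schrödinger operator is a multiplication has a constant
leading coefficient. -/
theorem D_leadingCoeff_eq_zero {p : Polynomial DiffPoly} {r : DiffPoly}
    (h : schrodinger * diffOp p - diffOp p * schrodinger = mulOp r) : D p.leadingCoeff = 0 := by
  choose N hN using exists_pderiv_eq_zero
  set n := p.natDegree with hn
  -- The commutator is tested on u⁽ᴷ⁾, with K beyond every variable occurring in the coefficients,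
  -- in their first two derivatives and in r. Then u⁽ᴷ⁺ⁿ⁺¹⁾ can only come from the cross term 2pₙ'∂
  -- of ∂² acting on the top term.
  set K := (Finset.range (n + 1)).sup (fun i => N (p.coeff i)) + N r + 3 with hK
  have hp : ∀ i ∈ Finset.range (n + 1), N (p.coeff i) + 3 ≤ K := fun i hi => by
    have := Finset.le_sup (f := fun i => N (p.coeff i)) hi
    omega
  have hD (i j : ℕ) : D^[i] (MvPolynomial.X j) = MvPolynomial.X (j + i) := by
    induction i with
    | zero => rfl
    | succ i ih => rw [Function.iterate_succ_apply', ih, D_X, add_assoc]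
  have hDs (i : ℕ) (f g : DiffPoly) : D^[i] (f - g) = D^[i] f - D^[i] g :=
    iterate_map_sub D i f g
  have h1 := LinearMap.congr_fun h (MvPolynomial.X K)
  simp only [schrodinger, pow_two, LinearMap.sub_apply, Module.End.mul_apply, mulOp_apply, dx_apply,
    D_X, diffOp_apply, ← hn, map_sum, hDs, hD] at h1
  rw [← Finset.sum_sub_distrib] at h1
  have hX : ∀ j ≥ K + 1,
      MvPolynomial.pderiv j (MvPolynomial.X 0 * MvPolynomial.X K : DiffPoly) = 0 :=
    fun j hj => by
      rw [Derivation.leibniz, MvPolynomial.pderiv_X_of_ne (by omega),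
        MvPolynomial.pderiv_X_of_ne (by omega), smul_zero, smul_zero, add_zero]
  have key : ∀ i ∈ Finset.range (n + 1), MvPolynomial.pderiv (K + n + 1)
      (D (D (p.coeff i * MvPolynomial.X (K + i))) - MvPolynomial.X 0 * (p.coeff i *
        MvPolynomial.X (K + i)) - p.coeff i * (MvPolynomial.X (K + 1 + 1 + i) -
        D^[i] (MvPolynomial.X 0 * MvPolynomial.X K)))
      = if i = n then 2 * D (p.coeff i) else 0 := by
    intro i hi
    have hi' := Finset.mem_range.1 hi
    have hKi := hp i hi
    have e : D (D (p.coeff i * MvPolynomial.X (K + i))) - MvPolynomial.X 0 * (p.coeff i *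
        MvPolynomial.X (K + i)) - p.coeff i * (MvPolynomial.X (K + 1 + 1 + i) -
        D^[i] (MvPolynomial.X 0 * MvPolynomial.X K))
        = D (D (p.coeff i)) * MvPolynomial.X (K + i)
          + (D (p.coeff i) * MvPolynomial.X (K + i + 1)
            + D (p.coeff i) * MvPolynomial.X (K + i + 1))
          - MvPolynomial.X 0 * (p.coeff i * MvPolynomial.X (K + i))
          + p.coeff i * D^[i] (MvPolynomial.X 0 * MvPolynomial.X K) := by
      simp only [Derivation.leibniz, map_add, smul_eq_mul, D_X]
      rw [show K + 1 + 1 + i = K + i + 1 + 1 by omega]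
      ring
    have p0 := hN (p.coeff i) (K + n + 1) (by omega)
    have p1 := pderiv_D_eq_zero (hN (p.coeff i))
    have p2 := pderiv_D_eq_zero p1 (K + n + 1) (by omega)
    have p3 := p1 (K + n + 1) (by omega)
    have x0 : MvPolynomial.pderiv (K + n + 1) (MvPolynomial.X 0 : DiffPoly) = 0 :=
      MvPolynomial.pderiv_X_of_ne (by omega)
    have xi : MvPolynomial.pderiv (K + n + 1) (MvPolynomial.X (K + i) : DiffPoly) = 0 :=
      MvPolynomial.pderiv_X_of_ne (by omega)
    have xd := pderiv_D_iterate_eq_zero hX i (K + n + 1) (by omega)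
    rw [e]
    simp only [Derivation.leibniz, map_add, map_sub, p0, p2, p3, x0, xi, xd, smul_eq_mul]
    split_ifs with hin
    · rw [hin, MvPolynomial.pderiv_X_self]; ring
    · rw [MvPolynomial.pderiv_X_of_ne (by omega)]; ring
  have h2 := congrArg (MvPolynomial.pderiv (K + n + 1)) h1
  have hz : MvPolynomial.pderiv (K + n + 1) (MvPolynomial.X K : DiffPoly) = 0 :=
    MvPolynomial.pderiv_X_of_ne (by omega)
  rw [map_sum, Finset.sum_congr rfl key, Finset.sum_ite_eq', if_pos (by simp), Derivation.leibniz,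
    hN r _ (by omega), hz, smul_zero, smul_zero, add_zero] at h2
  exact (mul_eq_zero.1 h2).resolve_left two_ne_zero

/-- A nonzero operator of order below d would have a leading coefficient that is both a constant and
homogeneous of positive weight, hence zero. This rigidity gives both the uniqueness and the
anti-symmetry of A_k. -/
theorem eq_zero_of_commutator {p : Polynomial DiffPoly} {r : DiffPoly} {d : ℕ}
    (hp : OpHomog p d) (hd : p.coeff d = 0)
    (h : schrodinger * diffOp p - diffOp p * schrodinger = mulOp r) : p = 0 := by
  by_contra hne
  have h1 := D_leadingCoeff_eq_zero h
  have h2 : p.coeff p.natDegree ≠ 0 := Polynomial.leadingCoeff_ne_zero.2 hne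
  have h3 : p.natDegree < d := by
    rcases lt_trichotomy p.natDegree d with h3 | h3 | h3
    · exact h3
    · exact absurd (h3 ▸ hd) h2
    · exact absurd (hp.eq_zero _ h3) h2
  refine h2 ?_
  rw [← Polynomial.leadingCoeff, eq_C_of_D_eq_zero h1, Polynomial.leadingCoeff,
    (hp.homog _ h3.le).constantCoeff_eq_zero (by omega), map_zero]

/-! ### The Lax pairs of the hierarchy -/

theorem lenard_recursion (k : ℕ) :
    4 * D (coeff (k + 1) (thetaSeries 0)) = D (D (D (coeff k (thetaSeries 0))))
      - 4 * MvPolynomial.X 0 * D (coeff k (thetaSeries 0))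
      - 2 * MvPolynomial.X 1 * coeff k (thetaSeries 0) := by
  have h := congrArg (coeff (k + 1)) (lenard_thetaSeries 0)
  rw [coeff_succ_lenard, map_zero] at h
  linear_combination h

theorem homog_curveSeries_coeff {F : DiffPoly⟦X⟧} {m : ℕ}
    (h : ∀ i ≤ m, Homog (coeff i F) (2 * i)) : Homog (coeff m (curveForm F)) (2 * m) := by
  have hmul {F G : DiffPoly⟦X⟧} {a b n : ℕ} (hF : ∀ i ≤ n, Homog (coeff i F) (2 * i + a))
      (hG : ∀ i ≤ n, Homog (coeff i G) (2 * i + b)) :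
      ∀ i ≤ n, Homog (coeff i (F * G)) (2 * i + (a + b)) := fun i hi => by
    rw [PowerSeries.coeff_mul]
    refine Submodule.sum_mem (MvPolynomial.weightedHomogeneousSubmodule ℂ _ _) fun q hq => ?_
    have hq' := Finset.HasAntidiagonal.mem_antidiagonal.1 hq
    change Homog _ _
    convert (hF q.1 (by omega)).mul (hG q.2 (by omega)) using 1
    omega
  have h1 : ∀ i ≤ m, Homog (coeff i (seriesDer D F)) (2 * i + 1) := fun i hi => by
    rw [coeff_seriesDer]; exact (h i hi).D
  have h2 : ∀ i ≤ m, Homog (coeff i (seriesDer D (seriesDer D F))) (2 * i + 2) := fun i hi => by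
    rw [coeff_seriesDer]; exact (h1 i hi).D
  have h3 := hmul h1 h1
  have h4 := hmul h2 (b := 0) h
  have h5 := hmul (a := 0) (b := 0) h h
  have e : curveForm F = PowerSeries.X * (seriesDer D F * seriesDer D F
      - PowerSeries.C (MvPolynomial.C 2) * (seriesDer D (seriesDer D F) * F)
      + PowerSeries.C (MvPolynomial.C 4 * MvPolynomial.X 0) * (F * F))
      + PowerSeries.C (MvPolynomial.C 4) * (F * F) := by
    simp only [curveForm, curveSeries, map_mul, map_ofNat]; ring
  rw [e, map_add, PowerSeries.coeff_C_mul]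
  have h6 := (h5 m le_rfl).C_mul 4
  refine MvPolynomial.IsWeightedHomogeneous.add ?_ h6
  rcases m with _ | m
  · rw [PowerSeries.coeff_zero_X_mul]; exact homog_zero _
  · rw [PowerSeries.coeff_succ_X_mul, map_add, map_sub, PowerSeries.coeff_C_mul,
      PowerSeries.coeff_C_mul, mul_assoc]
    have hX : Homog (MvPolynomial.X 0) 2 := MvPolynomial.isWeightedHomogeneous_X ℂ _ 0
    have h7 : Homog (MvPolynomial.X 0 * coeff m (F * F)) (2 * (m + 1)) := by
      simpa only [show 2 + (2 * m + (0 + 0)) = 2 * (m + 1) by omega] using hX.mul (h5 m (by omega))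
    exact ((h3 m (by omega)).sub ((h4 m (by omega)).C_mul 2)).add (h7.C_mul 4)

/-- With μ = 0 the constant series is 16, of weight zero. At order k > 0 the coefficient is
therefore -1/16 times an expression of weight 2k in the earlier ones. -/
theorem homog_thetaSeries_zero (k : ℕ) : Homog (coeff k (thetaSeries 0)) (2 * k) := by
  induction k using Nat.strong_induction_on with
  | _ k ih =>
    rcases Nat.eq_zero_or_pos k with rfl | hk
    · rw [coeff_zero_thetaSeries, ← map_ofNat (MvPolynomial.C (σ := ℕ) (R := ℂ))]
      exact homog_C 2
    · obtain ⟨G, hG⟩ : ∃ G : DiffPoly⟦X⟧, ∀ i, coeff i G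
          = if i < k then coeff i (thetaSeries 0) else 0 :=
        ⟨PowerSeries.mk fun i => if i < k then coeff i (thetaSeries 0) else 0, fun i => by
          rw [PowerSeries.coeff_mk]⟩
      have h1 := coeff_curveForm_sub (F := thetaSeries 0) (G := G) hk.ne'
        (fun i hi => by rw [hG, if_pos hi])
      have h2 : Homog (coeff k (curveForm G)) (2 * k) := by
        refine homog_curveSeries_coeff fun i _ => ?_
        rw [hG]
        split_ifs with h
        · exact ih i h
        · exact homog_zero _
      have h3 : coeff k (curveForm (thetaSeries 0)) = 0 := by
        rw [curveForm_thetaSeries, curveConst_zero, PowerSeries.coeff_map,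
          ← map_ofNat (PowerSeries.C (R := ℂ)), PowerSeries.coeff_C, if_neg hk.ne', map_zero]
      rw [h3, hG, hG, if_pos hk, if_neg (lt_irrefl k), coeff_zero_thetaSeries, sub_zero] at h1
      have h4 : coeff k (thetaSeries 0) = MvPolynomial.C (-1 / 16) * coeff k (curveForm G) := by
        have h16 : (16 : DiffPoly) * MvPolynomial.C (-1 / 16) = -1 := by
          rw [← map_ofNat (MvPolynomial.C (σ := ℕ) (R := ℂ)), ← map_mul]; norm_num
        refine mul_left_cancel₀ (show (16 : DiffPoly) ≠ 0 by norm_num) ?_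
        linear_combination -h1 - coeff k (curveForm G) * h16
      rw [h4]
      exact h2.C_mul _

/-- One quarter of the coefficient at `ξᵏ` of the homogeneous solution. -/
def quarter (k : ℕ) : DiffPoly := MvPolynomial.C (1 / 4) * coeff k (thetaSeries 0)

theorem quarter_recursion (k : ℕ) : 4 * D (quarter (k + 1)) = D (D (D (quarter k)))
    - 4 * MvPolynomial.X 0 * D (quarter k) - 2 * MvPolynomial.X 1 * quarter k := by
  simp only [quarter, D_C_mul]
  linear_combination MvPolynomial.C (1 / 4) * lenard_recursion k

theorem homog_quarter (k : ℕ) : Homog (quarter k) (2 * k) := (homog_thetaSeries_zero k).C_mul _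

theorem quarter_zero : quarter 0 = MvPolynomial.C (1 / 2) := by
  rw [quarter, coeff_zero_thetaSeries, ← map_ofNat (MvPolynomial.C (σ := ℕ) (R := ℂ)), ← map_mul]
  norm_num

theorem four_mul_D_quarter_succ (k : ℕ) : 4 * D (quarter (k + 1)) = -D (Theta 0 (k + 1)) := by
  rw [quarter, D_C_mul, coeff_thetaSeries 0 (Nat.succ_ne_zero k), map_neg, ← mul_assoc,
    ← map_ofNat (MvPolynomial.C (σ := ℕ) (R := ℂ)), ← map_mul]
  norm_num

theorem sum_constantCoeff_quarter (k : ℕ) :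
    ∑ j ∈ Finset.range (k + 1), 2 * constantCoeff (quarter j) = 1 := by
  rw [Finset.sum_range_succ', Finset.sum_eq_zero fun j _ => ?_, quarter_zero]
  · simp
  · rw [(homog_quarter (j + 1)).constantCoeff_eq_zero (by omega), mul_zero]

/-- The operator `A_k`. -/
def laxSum (k : ℕ) : Module.End ℂ DiffPoly :=
  ∑ j ∈ Finset.range (k + 1), laxOp (quarter j) * schrodinger ^ (k - j)

/-- The formal conjugate of `A_k`. -/
def laxSumAdj (k : ℕ) : Module.End ℂ DiffPoly :=
  ∑ j ∈ Finset.range (k + 1), schrodinger ^ (k - j) * laxOpAdj (quarter j)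

theorem homogOp_laxSum (k : ℕ) : HomogOp (2 * k + 1) 1 (laxSum k) (laxSumAdj k) := by
  rw [← sum_constantCoeff_quarter k]
  refine HomogOp.sum _ fun j hj => ?_
  have hj' := Finset.mem_range.1 hj
  have h := (HomogOp.one.schrodinger_pow_mul (k - j)).laxOp_mul (homog_quarter j)
  rw [mul_one, mul_one, one_mul] at h
  convert h using 1
  omega

/-- Only the order and the leading coefficient -1 of the conjugate matter, so that it cancels the
top term of `laxSum k`; its own conjugate T plays no role. -/
theorem exists_homogOp_laxSumAdj (k : ℕ) : ∃ T, HomogOp (2 * k + 1) (-1) (laxSumAdj k) T := by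
  choose T hT using fun j => HomogOp.exists_laxOpAdj (homog_quarter j)
  refine ⟨∑ j ∈ Finset.range (k + 1), T j * schrodinger ^ (k - j), ?_⟩
  rw [← sum_constantCoeff_quarter k, ← Finset.sum_neg_distrib]
  refine HomogOp.sum _ fun j hj => ?_
  have hj' := Finset.mem_range.1 hj
  convert (hT j).schrodinger_pow_mul (k - j) using 1
  omega

theorem mulOp_neg (f : DiffPoly) : mulOp (-f) = -mulOp f := LinearMap.ext fun g => by simp

theorem mulOp_four_D_quarter_zero : mulOp (4 * D (quarter 0)) = 0 := by
  rw [quarter_zero, D_C, mul_zero]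
  exact LinearMap.ext fun f => by simp

theorem commutator_laxSum (k : ℕ) :
    schrodinger * laxSum k - laxSum k * schrodinger = mulOp (D (Theta 0 (k + 1))) := by
  rw [laxSum, Finset.mul_sum, Finset.sum_mul, ← Finset.sum_sub_distrib]
  have h : ∀ j ∈ Finset.range (k + 1), schrodinger * (laxOp (quarter j) * schrodinger ^ (k - j))
      - laxOp (quarter j) * schrodinger ^ (k - j) * schrodinger
      = mulOp (4 * D (quarter j)) * schrodinger ^ (k + 1 - j)
        - mulOp (4 * D (quarter (j + 1))) * schrodinger ^ (k + 1 - (j + 1)) := fun j hj => by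
    have hj' := Finset.mem_range.1 hj
    rw [mul_assoc (laxOp (quarter j)), ← pow_succ, pow_succ', ← mul_assoc, ← mul_assoc, ← sub_mul,
      commutator_laxOp (quarter_recursion j), sub_mul, mul_assoc, ← pow_succ',
      show k - j + 1 = k + 1 - j by omega, Nat.add_sub_add_right]
  rw [Finset.sum_congr rfl h, Finset.sum_range_sub', mulOp_four_D_quarter_zero, zero_mul, zero_sub,
    four_mul_D_quarter_succ, Nat.sub_self, pow_zero, mul_one, mulOp_neg, neg_neg]

theorem commutator_laxSumAdj (k : ℕ) :
    schrodinger * laxSumAdj k - laxSumAdj k * schrodinger = -mulOp (D (Theta 0 (k + 1))) := by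
  rw [laxSumAdj, Finset.mul_sum, Finset.sum_mul, ← Finset.sum_sub_distrib]
  have h : ∀ j ∈ Finset.range (k + 1), schrodinger * (schrodinger ^ (k - j) * laxOpAdj (quarter j))
      - schrodinger ^ (k - j) * laxOpAdj (quarter j) * schrodinger
      = schrodinger ^ (k + 1 - (j + 1)) * mulOp (4 * D (quarter (j + 1)))
        - schrodinger ^ (k + 1 - j) * mulOp (4 * D (quarter j)) := fun j hj => by
    have hj' := Finset.mem_range.1 hj
    rw [mul_assoc (schrodinger ^ (k - j)), ← mul_assoc, ← pow_succ', pow_succ, mul_assoc, ← mul_sub,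
      commutator_laxOpAdj (quarter_recursion j), mul_sub, ← mul_assoc, ← pow_succ,
      show k - j + 1 = k + 1 - j by omega, Nat.add_sub_add_right]
  rw [Finset.sum_congr rfl h, Finset.sum_range_sub
      (fun j => schrodinger ^ (k + 1 - j) * mulOp (4 * D (quarter j))),
    mulOp_four_D_quarter_zero, mul_zero, sub_zero,
    four_mul_D_quarter_succ, Nat.sub_self, pow_zero, one_mul, mulOp_neg]

/-- The summands are not anti-symmetric one by one. The sum of A_k and its conjugate, however,
commutes with L and has no term of order 2k+1, so rigidity makes it zero. -/
theorem laxSumAdj_eq (k : ℕ) : laxSumAdj k = -laxSum k := by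
  obtain ⟨T, hT⟩ := exists_homogOp_laxSumAdj k
  obtain ⟨p, h1, h2, h3, -⟩ := (homogOp_laxSum k).add hT
  rw [add_neg_cancel, map_zero] at h2
  have h : schrodinger * diffOp p - diffOp p * schrodinger = mulOp 0 := by
    rw [h3, mul_add, add_mul, add_sub_add_comm, commutator_laxSum, commutator_laxSumAdj,
      add_neg_cancel]
    exact LinearMap.ext fun f => by simp
  rw [eq_zero_of_commutator h1 h2 h] at h3
  have h4 : diffOp 0 = 0 := Polynomial.sum_zero_index _
  rw [h4] at h3
  exact eq_neg_of_add_eq_zero_right h3.symm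

theorem exists_isLaxPair (k : ℕ) : ∃ p, IsLaxPair k p (D (Theta 0 (k + 1))) := by
  obtain ⟨p, h1, h2, h3, h4⟩ := homogOp_laxSum k
  rw [map_one] at h2
  have hdeg : p.natDegree = 2 * k + 1 :=
    le_antisymm (Polynomial.natDegree_le_iff_coeff_eq_zero.2 fun i hi => h1.eq_zero i hi)
      (Polynomial.le_natDegree_of_ne_zero (by rw [h2]; exact one_ne_zero))
  refine ⟨p, hdeg, ?_, h1.homog, ?_, ?_⟩
  · rw [Polynomial.Monic, Polynomial.leadingCoeff, hdeg, h2]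
  · rw [h3, h4, laxSumAdj_eq]
  · rw [h3, commutator_laxSum]

/-- Rigidity applied to the difference of the two operators, whose leading terms cancel.
Anti-symmetry does not enter. -/
theorem IsLaxPair.unique {k : ℕ} {p q : Polynomial DiffPoly} {r s : DiffPoly}
    (hp : IsLaxPair k p r) (hq : IsLaxPair k q s) : r = s := by
  have hadd : diffOp (p - q) + diffOp q = diffOp p := by rw [← diffOp_add, sub_add_cancel]
  have hsub : diffOp (p - q) = diffOp p - diffOp q := eq_sub_of_add_eq hadd
  have hz {p : Polynomial DiffPoly} (h : p.natDegree = 2 * k + 1) :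
      ∀ i > 2 * k + 1, p.coeff i = 0 := fun i hi =>
    Polynomial.coeff_eq_zero_of_natDegree_lt (by omega)
  have h1 : OpHomog (p - q) (2 * k + 1) :=
    ⟨fun i hi => by
      rw [Polynomial.coeff_sub]; exact (hp.homogeneous i hi).sub (hq.homogeneous i hi),
    fun i hi => by
      rw [Polynomial.coeff_sub, hz hp.natDegree_eq i hi, hz hq.natDegree_eq i hi, sub_zero]⟩
  have h2 : (p - q).coeff (2 * k + 1) = 0 := by
    have h3 := hp.monic.coeff_natDegree
    have h4 := hq.monic.coeff_natDegree
    rw [hp.natDegree_eq] at h3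
    rw [hq.natDegree_eq] at h4
    rw [Polynomial.coeff_sub, h3, h4, sub_self]
  have h5 : schrodinger * diffOp (p - q) - diffOp (p - q) * schrodinger = mulOp (r - s) := by
    rw [hsub, mul_sub, sub_mul, sub_sub_sub_comm, hp.commutator, hq.commutator]
    exact LinearMap.ext fun f => by simp [sub_mul]
  have h6 := sub_eq_zero.1 (eq_zero_of_commutator h1 h2 h5)
  have h7 := LinearMap.congr_fun (hp.commutator.symm.trans (h6 ▸ hq.commutator)) 1
  simpa using h7

/-- The right-hand side of the `k`-th KdV equation is the `x`-derivative of the `(k+1)`-st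
coefficient of the homogeneous solution. -/
theorem kdv_eq (k : ℕ) : kdv k = D (Theta 0 (k + 1)) := by
  obtain ⟨p, hp⟩ := Classical.epsilon_spec (p := fun r => ∃ p, IsLaxPair k p r)
    ⟨_, exists_isLaxPair k⟩
  obtain ⟨q, hq⟩ := exists_isLaxPair k
  exact hp.unique hq

theorem D_Theta_succ_eq_sum_kdv (μ : ℕ → ℂ) (k : ℕ) :
    D (Theta μ (k + 1)) = ∑ i ∈ Finset.range (k + 1),
      MvPolynomial.C (coeff i (rootSeries μ)) * kdv (k - i) := by
  rw [D_Theta_succ]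
  refine Finset.sum_congr rfl fun i hi => ?_
  rw [kdv_eq, show k + 1 - i = k - i + 1 by have := Finset.mem_range.1 hi; omega]

end DiffPoly

namespace DiffPoly

open MvPolynomial (constantCoeff)

local notation "∂ₛ" => seriesDer D

/-! ### Relations between the curve and the constants of the hierarchy -/

theorem sum_range_eq_add_sum_Icc {R : Type*} [CommRing R] {c : ℕ → R} (h0 : c 0 = 1) (h1 : c 1 = 0)
    (x : ℕ → R) (k : ℕ) : ∑ i ∈ Finset.range (k + 1), c i * x (k - i)
      = x k + ∑ i ∈ Finset.Icc 2 k, c i * x (k - i) := by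
  have hs : Finset.Icc 2 k ⊆ Finset.range (k + 1) := fun i hi => by simp at hi ⊢; omega
  rw [Finset.sum_range_succ', add_comm, h0, one_mul, Nat.sub_zero]
  congr 1
  rw [← Finset.sum_subset (s₁ := Finset.Icc 1 (k - 1))]
  · refine Finset.sum_nbij' (· + 1) (· - 1) ?_ ?_ ?_ ?_ ?_ <;> simp <;> omega
  · intro i hi; simp at hi ⊢; omega
  · intro i hi hi'
    obtain rfl : i = 0 := by simp at hi hi'; omega
    rw [h1, zero_mul]

theorem coeff_sq_eq {R : Type*} [CommRing R] {c : R⟦X⟧} (h0 : coeff 0 c = 1) (h1 : coeff 1 c = 0)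
    {k : ℕ} (hk : 1 ≤ k) : coeff (k + 1) (c ^ 2) = 2 * coeff (k + 1) c
      + ∑ i ∈ Finset.Icc 1 (k - 2), coeff (i + 1) c * coeff (k - i) c := by
  rw [pow_two, PowerSeries.coeff_mul,
    Finset.Nat.sum_antidiagonal_eq_sum_range_succ (fun i j => coeff i c * coeff j c),
    Finset.sum_range_succ, Finset.sum_range_succ', Nat.sub_self, Nat.sub_zero, h0,
    Finset.sum_subset (s₁ := Finset.Icc 1 (k - 2)) (s₂ := Finset.range k)]
  · simp only [Nat.add_sub_add_right]; ring
  · intro i hi; simp at hi ⊢; omega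
  · intro i hi hi'
    simp only [Finset.mem_range, Finset.mem_Icc, not_and, not_le] at hi hi'
    rcases Nat.eq_zero_or_pos i with rfl | hpos
    · rw [zero_add, h1, zero_mul]
    · rw [show k - i = 1 by have := hi' hpos; omega, h1, mul_zero]

theorem mu_eq (μ : ℕ → ℂ) {k : ℕ} (hk : 1 ≤ k) :
    μ k = 4 * (2 * coeff (k + 1) (rootSeries μ) + ∑ i ∈ Finset.Icc 1 (k - 2),
      coeff (i + 1) (rootSeries μ) * coeff (k - i) (rootSeries μ)) := by
  have h := congrArg (coeff (k + 1)) (curveConst_eq μ)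
  rw [curveConst, PowerSeries.coeff_mk, if_neg (by omega), if_neg (by omega), Nat.add_sub_cancel,
    ← map_ofNat (PowerSeries.C (R := ℂ)), PowerSeries.coeff_C_mul,
    coeff_sq_eq (coeff_zero_rootSeries μ) (coeff_one_rootSeries μ) hk] at h
  linear_combination h / 4

/-- The relations between `μ` and `a` say that the constants of the hierarchy are the coefficients
of the square root of the curve. -/
theorem mu_eq_muOfConstants_iff (g : ℕ) (a μ : ℕ → ℂ) :
    (∀ k ∈ Finset.Icc 1 (g - 1), μ k = muOfConstants g a k)
      ↔ ∀ i ∈ Finset.Icc 2 g, coeff i (rootSeries μ) = a (g - i) := by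
  -- The quadratic sum in μ_k involves only c_2, …, c_{k-1}, so the relations are triangular and can
  -- be solved for c_{k+1}.
  have hsum {k : ℕ} (hk : k ≤ g - 1) (h : ∀ i ∈ Finset.Icc 2 (k - 1),
      coeff i (rootSeries μ) = a (g - i)) :
      ∑ i ∈ Finset.Icc 1 (k - 2), coeff (i + 1) (rootSeries μ) * coeff (k - i) (rootSeries μ)
        = ∑ i ∈ Finset.Icc 1 (k - 2), a (g - i - 1) * a (g - k + i) := by
    refine Finset.sum_congr rfl fun i hi => ?_
    rw [Finset.mem_Icc] at hi
    rw [h (i + 1) (by simp; omega), h (k - i) (by simp; omega),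
      show g - (i + 1) = g - i - 1 by omega, show g - (k - i) = g - k + i by omega]
  constructor
  · intro h i
    induction i using Nat.strong_induction_on with
    | _ i ih =>
      intro hi
      rw [Finset.mem_Icc] at hi
      obtain ⟨k, rfl⟩ : ∃ k, i = k + 1 := ⟨i - 1, by omega⟩
      have h1 := h k (by simp; omega)
      rw [mu_eq μ (by omega), muOfConstants, hsum (by omega) fun j hj => by
        rw [Finset.mem_Icc] at hj
        exact ih j (by omega) (by simp; omega)] at h1
      rw [show g - (k + 1) = g - k - 1 by omega]
      linear_combination h1 / 8
  · intro h k hk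
    rw [Finset.mem_Icc] at hk
    rw [mu_eq μ hk.1, muOfConstants, hsum hk.2 fun i hi => by
      rw [Finset.mem_Icc] at hi
      exact h i (by simp; omega), h (k + 1) (by simp; omega),
      show g - (k + 1) = g - k - 1 by omega]
    ring

theorem D_Theta_succ_eq_flow {g : ℕ} {a μ : ℕ → ℂ}
    (h : ∀ i ∈ Finset.Icc 2 g, coeff i (rootSeries μ) = a (g - i)) {k : ℕ} (hk : k ≤ g) :
    D (Theta μ (k + 1)) = flow g a k := by
  rw [D_Theta_succ_eq_sum_kdv, sum_range_eq_add_sum_Icc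
    (c := fun i => MvPolynomial.C (coeff i (rootSeries μ)))
    (by rw [coeff_zero_rootSeries, map_one]) (by rw [coeff_one_rootSeries, map_zero]), flow,
    add_right_inj]
  refine Finset.sum_congr rfl fun i hi => ?_
  rw [Finset.mem_Icc] at hi
  rw [h i (by simp; omega)]

theorem flow_self (g : ℕ) (a : ℕ → ℂ) : flow g a g = stationary g a := by
  rw [flow, stationary, add_right_inj]
  refine Finset.sum_nbij' (g - ·) (g - ·) ?_ ?_ ?_ ?_ fun i _ => rfl <;> simp <;> omega

theorem Theta_congr {μ ν : ℕ → ℂ} {k : ℕ} (h : ∀ i ∈ Finset.Icc 1 (k - 1), μ i = ν i) :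
    Theta μ k = Theta ν k := by
  induction k using Nat.strong_induction_on with
  | _ k ih =>
    match k with
    | 0 => rw [Theta, Theta]
    | 1 => rw [Theta, Theta]
    | k + 2 =>
      rw [Theta, Theta, h (k + 1) (by simp)]
      congr 4
      funext i
      split_ifs with hi
      · refine ih i hi fun j hj => h j ?_
        rw [Finset.mem_Icc] at hj ⊢
        omega
      · rfl

/-! ### Evolutionary derivations -/

/-- The derivation that commutes with `d/dx` and maps `u` to `r`. -/
def evol (r : DiffPoly) : Derivation ℂ DiffPoly DiffPoly :=
  MvPolynomial.mkDerivation ℂ fun j => D^[j] r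

@[simp] theorem evol_X (r : DiffPoly) (j : ℕ) : evol r (MvPolynomial.X j) = D^[j] r :=
  MvPolynomial.mkDerivation_X ℂ _ j

theorem evol_D (r f : DiffPoly) : evol r (D f) = D (evol r f) := by
  have h : ⁅evol r, D⁆ = 0 := by
    refine MvPolynomial.derivation_ext fun i => ?_
    rw [Derivation.commutator_apply, D_X, evol_X, evol_X, Function.iterate_succ_apply', sub_self]
    rfl
  have h1 := congrArg (fun d => d f) h
  rw [Derivation.commutator_apply] at h1
  exact sub_eq_zero.1 h1

theorem evol_D_iterate (r f : DiffPoly) (i : ℕ) : evol r (D^[i] f) = D^[i] (evol r f) := by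
  induction i with
  | zero => rfl
  | succ i ih => rw [Function.iterate_succ_apply', evol_D, ih, Function.iterate_succ_apply']

theorem constantCoeff_evol_D (r f : DiffPoly) : constantCoeff (evol (D r) f) = 0 :=
  constantCoeff_mkDerivation _ (fun j => by
    rw [← Function.iterate_succ_apply, Function.iterate_succ_apply', constantCoeff_D]) f

theorem seriesDer_evol_comm (r : DiffPoly) (F : DiffPoly⟦X⟧) :
    seriesDer (evol r) (∂ₛ F) = ∂ₛ (seriesDer (evol r) F) := by
  ext1 n
  simp only [coeff_seriesDer, evol_D]

/-- Solutions of the symmetric square of a second-order equation are closed under Wronskians; this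
is the version with defects, needed because P will be a truncation. -/
theorem lenard_wronskian (P F : DiffPoly⟦X⟧) : lenard (P * ∂ₛ F - ∂ₛ P * F)
    = 2 * ∂ₛ P * lenard F + P * ∂ₛ (lenard F) - 2 * ∂ₛ F * lenard P - F * ∂ₛ (lenard P) := by
  have h2 : ∂ₛ (2 : DiffPoly⟦X⟧) = 0 := seriesDer_ofNat D 2
  have h4 : ∂ₛ (4 : DiffPoly⟦X⟧) = 0 := seriesDer_ofNat D 4
  simp only [lenard, Derivation.leibniz, map_add, map_sub, map_neg, seriesDer_X, seriesDer_C, D_X,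
    smul_eq_mul, h2, h4, Derivation.map_one_eq_zero]
  ring

theorem lenard_sub (F G : DiffPoly⟦X⟧) : lenard (F - G) = lenard F - lenard G := by
  simp only [lenard, map_sub]; ring

theorem lenard_two_mul_X_pow_mul (k : ℕ) (F : DiffPoly⟦X⟧) :
    lenard (2 * (PowerSeries.X ^ k * F)) = 2 * (PowerSeries.X ^ k * lenard F) := by
  have h2 : ∂ₛ (2 : DiffPoly⟦X⟧) = 0 := seriesDer_ofNat D 2
  have h (G : DiffPoly⟦X⟧) : ∂ₛ (2 * (PowerSeries.X ^ k * G)) = 2 * (PowerSeries.X ^ k * ∂ₛ G) := by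
    rw [Derivation.leibniz, Derivation.leibniz, Derivation.leibniz_pow, seriesDer_X, h2]
    simp only [smul_eq_mul, mul_zero, smul_zero, add_zero]
  rw [lenard, h, h, h, lenard]
  ring

/-- The two corrections come from the coefficients of the operator, since u ↦ r and u' ↦ r'. -/
theorem lenard_seriesDer_evol (r : DiffPoly) (F : DiffPoly⟦X⟧) :
    lenard (seriesDer (evol r) F) = seriesDer (evol r) (lenard F)
      - 4 * (PowerSeries.C r * PowerSeries.X) * ∂ₛ F
      - 2 * (PowerSeries.C (D r) * PowerSeries.X) * F := by
  have h2 : seriesDer (evol r) (2 : DiffPoly⟦X⟧) = 0 := seriesDer_ofNat _ 2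
  have h4 : seriesDer (evol r) (4 : DiffPoly⟦X⟧) = 0 := seriesDer_ofNat _ 4
  simp only [lenard, Derivation.leibniz, map_add, map_neg, seriesDer_X, seriesDer_C, evol_X,
    smul_eq_mul, h2, h4, Derivation.map_one_eq_zero, seriesDer_evol_comm,
    Function.iterate_zero_apply, Function.iterate_one]
  ring

/-- A solution of the recursion without constant terms vanishes. -/
theorem eq_zero_of_lenard {Y : DiffPoly⟦X⟧} (h : lenard Y = 0)
    (hc : PowerSeries.map constantCoeff Y = 0) : Y = 0 := by
  have hz {f : DiffPoly} (h4 : 4 * D f = 0) (h0 : constantCoeff f = 0) : f = 0 := by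
    have h5 : D f = 0 := (mul_eq_zero.1 h4).resolve_left (by norm_num)
    rw [eq_C_of_D_eq_zero h5, h0, map_zero]
  have hc' (i : ℕ) : constantCoeff (coeff i Y) = 0 := by
    rw [← PowerSeries.coeff_map, hc, map_zero]
  ext1 i
  rw [map_zero]
  induction i with
  | zero => exact hz (by rw [← coeff_zero_lenard, h, map_zero]) (hc' 0)
  | succ i ih =>
    have h1 := coeff_succ_lenard Y i
    rw [h, ih] at h1
    exact hz (by simpa using h1.symm) (hc' _)

/-- The recursion links neighbouring orders only, so cutting F off after order k leaves a single
defect, at ξᵏ⁺¹. -/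
theorem lenard_trunc {F P : DiffPoly⟦X⟧} (hF : lenard F = 0) {k : ℕ}
    (hP : ∀ i, coeff i P = if i ≤ k then coeff i F else 0) :
    lenard P = PowerSeries.C (4 * -D (coeff (k + 1) F)) * PowerSeries.X ^ (k + 1) := by
  ext1 i
  rw [PowerSeries.coeff_C_mul, PowerSeries.coeff_X_pow]
  rcases i with _ | i
  · rw [coeff_zero_lenard, hP, if_pos (Nat.zero_le _), ← coeff_zero_lenard, hF]
    simp
  · have h := coeff_succ_lenard F i
    rw [hF, map_zero] at h
    rw [coeff_succ_lenard, hP, hP]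
    rcases lt_trichotomy i k with h1 | rfl | h1
    · rw [if_pos (by omega), if_pos (by omega), if_neg (by omega), mul_zero, ← h]
    · rw [if_neg (by omega), if_pos le_rfl, if_pos rfl, map_zero]
      linear_combination -h
    · rw [if_neg (by omega), if_neg (by omega), if_neg (by omega)]
      simp

/-- The evolution of the generating series along the flow number `k`. -/
theorem two_mul_X_pow_mul_seriesDer_evol {F P : DiffPoly⟦X⟧} (hF : lenard F = 0) {k : ℕ}
    (hP : ∀ i, coeff i P = if i ≤ k then coeff i F else 0) :
    2 * (PowerSeries.X ^ k * seriesDer (evol (-D (coeff (k + 1) F))) F)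
      = P * ∂ₛ F - ∂ₛ P * F := by
  rw [← sub_eq_zero]
  refine eq_zero_of_lenard ?_ ?_
  -- With r = -D F_{k+1} the truncation has defect 4rξᵏ⁺¹, so both sides are sent by `lenard` to
  -- -8rξᵏ⁺¹F' - 4r'ξᵏ⁺¹F.
  · have h4 : ∂ₛ (4 : DiffPoly⟦X⟧) = 0 := seriesDer_ofNat D 4
    rw [lenard_sub, lenard_two_mul_X_pow_mul, lenard_seriesDer_evol, lenard_wronskian, hF,
      lenard_trunc hF hP]
    simp only [map_zero, Derivation.leibniz, Derivation.leibniz_pow, seriesDer_X, seriesDer_C,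
      smul_zero, smul_eq_mul, map_mul, map_neg, pow_succ, mul_zero, zero_add, add_zero, map_ofNat,
      h4]
    ring
  · have h1 : PowerSeries.map constantCoeff
        (seriesDer (evol (-D (coeff (k + 1) F))) F) = 0 := by
      ext1 n
      rw [PowerSeries.coeff_map, coeff_seriesDer, ← map_neg, constantCoeff_evol_D, map_zero]
    have h2 : ∀ G : DiffPoly⟦X⟧, PowerSeries.map constantCoeff (∂ₛ G) = 0 := fun G => by
      ext n; simp
    rw [map_sub, map_mul, map_mul, h1, map_sub, map_mul, map_mul, h2, h2]
    simp

theorem derivation_mem_span {d : Derivation ℂ DiffPoly DiffPoly} {s : Set DiffPoly}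
    (h : ∀ f ∈ s, d f ∈ Ideal.span s) {f : DiffPoly} (hf : f ∈ Ideal.span s) :
    d f ∈ Ideal.span s := by
  induction hf using Submodule.span_induction with
  | mem f hf => exact h f hf
  | zero => rw [map_zero]; exact Ideal.zero_mem _
  | add f g _ _ hf hg => rw [map_add]; exact Ideal.add_mem _ hf hg
  | smul a f hf' hf =>
    rw [smul_eq_mul, Derivation.leibniz]
    exact Ideal.add_mem _ (Ideal.mul_mem_left _ _ hf) (Ideal.mul_mem_right _ _ hf')

/-- The coefficients of `curveForm T`, where `T` is a solution of the recursion truncated at the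
order `g`, are constant along the flows at the points where the truncated coefficients vanish
together with their `x`-derivatives. -/
theorem eval_evol_coeff_curveForm {F T : DiffPoly⟦X⟧} {g : ℕ} (φ : DiffPoly →+* ℂ)
    (hF : ∀ d : Derivation ℂ DiffPoly DiffPoly, seriesDer d (curveForm F) = 0)
    (h0 : coeff 0 F = 2) (hT : ∀ i, coeff i T = if i ≤ g then coeff i F else 0)
    (hφ : ∀ s > g, ∀ i, φ (D^[i] (coeff s F)) = 0) (k j : ℕ) :
    φ (evol (-D (coeff (k + 1) F)) (coeff j (curveForm T))) = 0 := by
  set d := evol (-D (coeff (k + 1) F)) with hd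
  set S : Set DiffPoly := {f | ∃ s > g, ∃ i, f = D^[i] (coeff s F)} with hS
  have hL : lenard F = 0 := lenard_eq_zero_of_seriesDer_curveForm h0 (hF D)
  have hDI : ∀ f ∈ Ideal.span S, D f ∈ Ideal.span S := fun f hf => by
    refine derivation_mem_span ?_ hf
    rintro _ ⟨s, hs, i, rfl⟩
    exact Ideal.subset_span ⟨s, hs, i + 1, (Function.iterate_succ_apply' _ _ _).symm⟩
  have hDI' (i : ℕ) : ∀ f ∈ Ideal.span S, D^[i] f ∈ Ideal.span S := by
    induction i with
    | zero => exact fun f hf => hf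
    | succ i ih => intro f hf; rw [Function.iterate_succ_apply']; exact hDI _ (ih f hf)
  have hdS : ∀ f ∈ S, d f ∈ Ideal.span S := by
    rintro _ ⟨s, hs, i, rfl⟩
    rw [hd, evol_D_iterate]
    refine hDI' i _ ?_
    obtain ⟨P, hP⟩ : ∃ P : DiffPoly⟦X⟧, ∀ i, coeff i P = if i ≤ k then coeff i F else 0 :=
      ⟨PowerSeries.mk fun i => if i ≤ k then coeff i F else 0, fun i => PowerSeries.coeff_mk _ _⟩
    -- P has no terms beyond order k, so every surviving product at order s + k has its factor from
    -- F at an order at least s, hence above g.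
    have h1 := congrArg (coeff (s + k)) (two_mul_X_pow_mul_seriesDer_evol hL hP)
    rw [← map_ofNat (PowerSeries.C (R := DiffPoly)), PowerSeries.coeff_C_mul,
      PowerSeries.coeff_X_pow_mul, coeff_seriesDer, ← hd, map_sub, PowerSeries.coeff_mul,
      PowerSeries.coeff_mul, ← Finset.sum_sub_distrib] at h1
    have h2 : 2 * d (coeff s F) ∈ Ideal.span S := by
      rw [h1]
      refine Ideal.sum_mem _ fun q hq => ?_
      have hq' := Finset.HasAntidiagonal.mem_antidiagonal.1 hq
      rw [coeff_seriesDer, coeff_seriesDer, hP]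
      split_ifs with h
      · have hm : coeff q.2 F ∈ Ideal.span S := Ideal.subset_span ⟨q.2, by omega, 0, rfl⟩
        exact Ideal.sub_mem _ (Ideal.mul_mem_left _ _ (hDI _ hm)) (Ideal.mul_mem_left _ _ hm)
      · rw [map_zero, zero_mul, zero_mul, sub_zero]
        exact Ideal.zero_mem _
    have h3 : d (coeff s F) = MvPolynomial.C (1 / 2) * (2 * d (coeff s F)) := by
      rw [← mul_assoc, ← map_ofNat (MvPolynomial.C (σ := ℕ) (R := ℂ)), ← map_mul]
      norm_num
    rw [h3]
    exact Ideal.mul_mem_left _ _ h2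
  have hφI : Ideal.span S ≤ RingHom.ker φ := by
    refine Ideal.span_le.2 ?_
    rintro _ ⟨s, hs, i, rfl⟩
    exact hφ s hs i
  -- F and T agree modulo the D-stable ideal together with their derivatives, so their forms agree
  -- modulo it.
  have hmem : coeff j (curveForm F) - coeff j (curveForm T) ∈ Ideal.span S := by
    have hFT (i : ℕ) : coeff i F - coeff i T ∈ Ideal.span S := by
      rw [hT]
      split_ifs with h
      · rw [sub_self]; exact Ideal.zero_mem _
      · rw [sub_zero]; exact Ideal.subset_span ⟨i, by omega, 0, rfl⟩
    have e0 : PowerSeries.map (Ideal.Quotient.mk (Ideal.span S)) F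
        = PowerSeries.map (Ideal.Quotient.mk (Ideal.span S)) T := by
      ext1 i
      rw [PowerSeries.coeff_map, PowerSeries.coeff_map]
      exact Ideal.Quotient.eq.2 (hFT i)
    have e1 : PowerSeries.map (Ideal.Quotient.mk (Ideal.span S)) (∂ₛ F)
        = PowerSeries.map (Ideal.Quotient.mk (Ideal.span S)) (∂ₛ T) := by
      ext1 i
      rw [PowerSeries.coeff_map, PowerSeries.coeff_map, coeff_seriesDer, coeff_seriesDer]
      refine Ideal.Quotient.eq.2 ?_
      rw [← map_sub]
      exact hDI _ (hFT i)
    have e2 : PowerSeries.map (Ideal.Quotient.mk (Ideal.span S)) (∂ₛ (∂ₛ F))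
        = PowerSeries.map (Ideal.Quotient.mk (Ideal.span S)) (∂ₛ (∂ₛ T)) := by
      ext1 i
      simp only [PowerSeries.coeff_map, coeff_seriesDer]
      refine Ideal.Quotient.eq.2 ?_
      rw [← map_sub, ← map_sub]
      exact hDI _ (hDI _ (hFT i))
    refine Ideal.Quotient.eq.1 ?_
    rw [← PowerSeries.coeff_map, ← PowerSeries.coeff_map, curveForm, curveForm, map_curveSeries,
      map_curveSeries, e0, e1, e2]
  have h1 := hφI (derivation_mem_span hdS hmem)
  have h2 := congrArg (coeff j) (hF d)
  rw [coeff_seriesDer, map_zero] at h2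
  rw [map_sub, h2, zero_sub, RingHom.mem_ker, map_neg, neg_eq_zero] at h1
  exact h1

/-- The differential polynomials that vanish at a point together with their derivatives. -/
def jetIdeal (φ : DiffPoly →+* ℂ) : Ideal DiffPoly where
  carrier := {f | ∀ i, φ (D^[i] f) = 0}
  zero_mem' i := by rw [iterate_map_zero, map_zero]
  add_mem' hf hg i := by rw [iterate_map_add, map_add, hf i, hg i, add_zero]
  smul_mem' c f hf i := by
    induction i generalizing c f with
    | zero => rw [Function.iterate_zero_apply, smul_eq_mul, map_mul,
        show φ f = 0 from hf 0, mul_zero]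
    | succ i ih =>
      rw [Function.iterate_succ_apply, smul_eq_mul, Derivation.leibniz, iterate_map_add, map_add,
        ih c (D f) fun i => hf (i + 1), smul_eq_mul, mul_comm f, ← smul_eq_mul, ih (D c) f hf,
        add_zero]

theorem mem_jetIdeal_of_D {φ : DiffPoly →+* ℂ} {f : DiffPoly} (h0 : φ f = 0)
    (h : D f ∈ jetIdeal φ) : f ∈ jetIdeal φ
  | 0 => h0
  | i + 1 => h i

theorem D_mem_jetIdeal {φ : DiffPoly →+* ℂ} {f : DiffPoly} (h : f ∈ jetIdeal φ) :
    D f ∈ jetIdeal φ := fun i => h (i + 1)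

/-- The recursion expresses D F_{s+1} through F_s and its derivatives, and the assumed value at the
point replaces the constant of integration. -/
theorem mem_jetIdeal_of_lenard {φ : DiffPoly →+* ℂ} {F : DiffPoly⟦X⟧} (hF : lenard F = 0) {g : ℕ}
    (hg : D (coeff (g + 1) F) ∈ jetIdeal φ) (h0 : ∀ s > g, φ (coeff s F) = 0) :
    ∀ s > g, coeff s F ∈ jetIdeal φ := by
  intro s hs
  induction s, hs using Nat.le_induction with
  | base => exact mem_jetIdeal_of_D (h0 _ (by omega)) hg
  | succ s hs ih =>
    refine mem_jetIdeal_of_D (h0 _ (by omega)) ?_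
    have h := coeff_succ_lenard F s
    rw [hF, map_zero] at h
    have h1 : D (coeff (s + 1) F) = MvPolynomial.C (1 / 4) * (D (D (D (coeff s F)))
        - 4 * MvPolynomial.X 0 * D (coeff s F) - 2 * MvPolynomial.X 1 * coeff s F) := by
      have h4 : MvPolynomial.C (1 / 4) * (4 : DiffPoly) = 1 := by
        rw [← map_ofNat (MvPolynomial.C (σ := ℕ) (R := ℂ)), ← map_mul]; norm_num
      linear_combination -D (coeff (s + 1) F) * h4 - MvPolynomial.C (1 / 4) * h
    rw [h1]
    have hD := D_mem_jetIdeal ih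
    exact Ideal.mul_mem_left _ _ (Ideal.sub_mem _ (Ideal.sub_mem _
      (D_mem_jetIdeal (D_mem_jetIdeal hD)) (Ideal.mul_mem_left _ _ hD))
      (Ideal.mul_mem_left _ _ ih))

/-- The evaluated series t starts with 2, hence is invertible; the factor is the quotient of its
truncation at order g by t itself. -/
theorem exists_constSeries_mul_vanishing (φ : DiffPoly →+* ℂ) (hφ : ∀ c, φ (MvPolynomial.C c) = c)
    {F : DiffPoly⟦X⟧} (h0 : coeff 0 F = 2) (g : ℕ) :
    ∃ q : ℂ⟦X⟧, ∀ s > g,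
      φ (coeff s (constSeries (1 + PowerSeries.X ^ (g + 1) * q) * F)) = 0 := by
  obtain ⟨t, ht⟩ : ∃ t : ℂ⟦X⟧, t = PowerSeries.map φ F := ⟨_, rfl⟩
  obtain ⟨h, hh⟩ : ∃ h : ℂ⟦X⟧, ∀ i, coeff i h = if i ≤ g then coeff i t else 0 :=
    ⟨PowerSeries.mk fun i => if i ≤ g then coeff i t else 0, fun i => PowerSeries.coeff_mk _ _⟩
  obtain ⟨Q, hQ⟩ := exists_eq_add_X_pow_mul (F := h) (G := t) (m := g + 1)
    fun i hi => by rw [hh, if_pos (by omega)]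
  have ht0 : PowerSeries.constantCoeff t ≠ 0 := by
    rw [ht, ← PowerSeries.coeff_zero_eq_constantCoeff_apply, PowerSeries.coeff_map, h0, map_ofNat]
    exact two_ne_zero
  refine ⟨Q * t⁻¹, fun s hs => ?_⟩
  rw [← PowerSeries.coeff_map, map_mul, ← ht]
  have h1 : PowerSeries.map φ (constSeries (1 + PowerSeries.X ^ (g + 1) * (Q * t⁻¹)))
      = 1 + PowerSeries.X ^ (g + 1) * (Q * t⁻¹) := by
    ext1 n
    rw [PowerSeries.coeff_map, PowerSeries.coeff_map, MvPolynomial.algebraMap_eq, hφ]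
  have h2 : (1 + PowerSeries.X ^ (g + 1) * (Q * t⁻¹)) * t = h := by
    rw [hQ]
    linear_combination PowerSeries.X ^ (g + 1) * Q * PowerSeries.inv_mul_cancel t ht0
  rw [h1, h2, hh, if_neg (by omega)]

/-- At a point whose jet satisfies the stationary equation, the coefficients of the curve are
constant along the flows. -/
theorem eval_evol_flow_curveCoeff {g : ℕ} {a μ : ℕ → ℂ}
    (hμ : ∀ i ∈ Finset.Icc 2 g, coeff i (rootSeries μ) = a (g - i)) (φ : DiffPoly →+* ℂ)
    (hφ : ∀ c, φ (MvPolynomial.C c) = c) (hs : stationary g a ∈ jetIdeal φ) {k : ℕ} (hk : k < g)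
    (j : ℕ) : φ (evol (flow g a k) (curveCoeff g (Theta μ) j)) = 0 := by
  -- The factor depends on the point, which is harmless: the claim is pointwise, and the
  -- coefficients up to order g do not change.
  obtain ⟨q, hq⟩ := exists_constSeries_mul_vanishing φ hφ (coeff_zero_thetaSeries μ) g
  obtain ⟨F, hF⟩ : ∃ F, F = constSeries (1 + PowerSeries.X ^ (g + 1) * q) * thetaSeries μ :=
    ⟨_, rfl⟩
  rw [← hF] at hq
  have hF' : F = thetaSeries μ + PowerSeries.X ^ (g + 1) * (constSeries q * thetaSeries μ) := by
    rw [hF, map_add, map_one, map_mul, map_pow, PowerSeries.map_X]; ring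
  have hle (i : ℕ) (hi : i ≤ g) : coeff i F = coeff i (thetaSeries μ) := by
    rw [hF', map_add, PowerSeries.coeff_X_pow_mul', if_neg (by omega), add_zero]
  have hflow {k : ℕ} (hk : k < g) : -D (coeff (k + 1) F) = flow g a k := by
    rw [hle _ (by omega), coeff_thetaSeries μ (Nat.succ_ne_zero k), map_neg, neg_neg,
      D_Theta_succ_eq_flow hμ hk.le]
  -- At order g + 1 the factor adds only the constant 2q_0, which D does not see.
  have hstat : D (coeff (g + 1) F) = -stationary g a := by
    have h1 : coeff (g + 1) (PowerSeries.X ^ (g + 1) * (constSeries q * thetaSeries μ))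
        = MvPolynomial.C (coeff 0 q * 2) := by
      have := PowerSeries.coeff_X_pow_mul (constSeries q * thetaSeries μ) (g + 1) 0
      rw [zero_add] at this
      rw [this, PowerSeries.coeff_mul, Finset.Nat.antidiagonal_zero, Finset.sum_singleton,
        PowerSeries.coeff_map, coeff_zero_thetaSeries, map_mul, map_ofNat,
        MvPolynomial.algebraMap_eq]
    rw [hF', map_add, h1, map_add, D_C, add_zero, coeff_thetaSeries μ (Nat.succ_ne_zero g),
      map_neg, D_Theta_succ_eq_flow hμ le_rfl, flow_self]
  have hL : lenard F = 0 := by rw [hF, lenard_constSeries_mul, lenard_thetaSeries, mul_zero]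
  have hd (d : Derivation ℂ DiffPoly DiffPoly) : seriesDer d (curveForm F) = 0 := by
    rw [hF, curveForm_constSeries_mul, curveForm_thetaSeries, ← map_mul, seriesDer_map_algebraMap]
  have hker := mem_jetIdeal_of_lenard hL (hstat ▸ (jetIdeal φ).neg_mem hs) hq
  rw [curveCoeff_eq, ← hflow hk]
  refine eval_evol_coeff_curveForm φ hd (by rw [hle 0 (Nat.zero_le _), coeff_zero_thetaSeries])
    (fun i => ?_) (fun s hs => hker s hs) k _
  split_ifs with hi
  · rw [coeff_two_sub_genFun_Theta μ hi, hle i hi]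
  · rw [map_sub, Polynomial.coeff_coe, coeff_genFun, ← map_ofNat (PowerSeries.C (R := DiffPoly)),
      PowerSeries.coeff_C, if_neg (by omega), if_neg (by omega), sub_zero]

end DiffPoly

/-! ### Partial derivatives of differential polynomials evaluated on the jets of a function. -/

section Calculus

variable {𝕜 : Type*} [RCLike 𝕜] [NormedAlgebra 𝕜 ℂ] {n : ℕ} {U : Set (Fin (n + 1) → 𝕜)}
  {u f h : (Fin (n + 1) → 𝕜) → ℂ}

theorem pderiv_congr (hU : IsOpen U) (hfh : ∀ t ∈ U, f t = h t) (k : Fin (n + 1)) :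
    ∀ t ∈ U, pderiv k f t = pderiv k h t := fun t ht => by
  have h1 : f =ᶠ[nhds t] h := Filter.eventuallyEq_of_mem (hU.mem_nhds ht) hfh
  rw [pderiv, pderiv, h1.fderiv_eq]

theorem contDiffOn_pderiv (hU : IsOpen U) (hf : ContDiffOn 𝕜 ∞ f U) (k : Fin (n + 1)) :
    ContDiffOn 𝕜 ∞ (pderiv k f) U :=
  (hf.fderiv_of_isOpen hU (m := ∞) (by simp)).clm_apply contDiffOn_const

theorem differentiableAt_of_contDiffOn (hU : IsOpen U) (hf : ContDiffOn 𝕜 ∞ f U)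
    {t : Fin (n + 1) → 𝕜} (ht : t ∈ U) : DifferentiableAt 𝕜 f t :=
  (hf.contDiffAt (hU.mem_nhds ht)).differentiableAt (by simp)

theorem pderiv_add (hU : IsOpen U) (hf : ContDiffOn 𝕜 ∞ f U) (hh : ContDiffOn 𝕜 ∞ h U)
    (k : Fin (n + 1)) {t : Fin (n + 1) → 𝕜} (ht : t ∈ U) :
    pderiv k (fun t => f t + h t) t = pderiv k f t + pderiv k h t := by
  rw [pderiv, fderiv_fun_add (differentiableAt_of_contDiffOn hU hf ht)
    (differentiableAt_of_contDiffOn hU hh ht)]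
  rfl

theorem pderiv_mul (hU : IsOpen U) (hf : ContDiffOn 𝕜 ∞ f U) (hh : ContDiffOn 𝕜 ∞ h U)
    (k : Fin (n + 1)) {t : Fin (n + 1) → 𝕜} (ht : t ∈ U) :
    pderiv k (fun t => f t * h t) t = f t * pderiv k h t + h t * pderiv k f t := by
  rw [pderiv, fderiv_fun_mul (differentiableAt_of_contDiffOn hU hf ht)
    (differentiableAt_of_contDiffOn hU hh ht)]
  rfl

theorem pderiv_const (k : Fin (n + 1)) (c : ℂ) (t : Fin (n + 1) → 𝕜) :
    pderiv k (fun _ => c) t = 0 := by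
  rw [pderiv, fderiv_fun_const]
  rfl

theorem pderiv_comm (hU : IsOpen U) (hf : ContDiffOn 𝕜 ∞ f U) (k l : Fin (n + 1)) :
    ∀ t ∈ U, pderiv k (pderiv l f) t = pderiv l (pderiv k f) t := fun t ht => by
  have h2 : DifferentiableAt 𝕜 (fderiv 𝕜 f) t :=
    ((hf.fderiv_of_isOpen hU (m := ∞) (by simp)).contDiffAt (hU.mem_nhds ht)).differentiableAt
      (by simp)
  have h3 (v w : Fin (n + 1) → 𝕜) :
      fderiv 𝕜 (fun t => fderiv 𝕜 f t v) t w = fderiv 𝕜 (fderiv 𝕜 f) t w v := by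
    rw [fderiv_clm_apply h2 (differentiableAt_const v)]
    simp
  have hs : IsSymmSndFDerivAt 𝕜 f t :=
    (hf.contDiffAt (hU.mem_nhds ht)).isSymmSndFDerivAt (by
      rw [minSmoothness_of_isRCLikeNormedField]
      exact WithTop.coe_mono (le_top : (2 : ℕ∞) ≤ ⊤))
  change fderiv 𝕜 (fun t => fderiv 𝕜 f t _) t _ = fderiv 𝕜 (fun t => fderiv 𝕜 f t _) t _
  rw [h3, h3]
  exact hs _ _

theorem eq_of_pderiv_eq_zero (hU : IsOpen U) (hUc : IsConnected U) (hf : ContDiffOn 𝕜 ∞ f U)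
    (h0 : ∀ k, ∀ t ∈ U, pderiv k f t = 0) {s t : Fin (n + 1) → 𝕜} (hs : s ∈ U) (ht : t ∈ U) :
    f s = f t := by
  refine hU.is_const_of_fderiv_eq_zero (𝕜 := 𝕜) hUc.isPreconnected
    (fun t ht => (differentiableAt_of_contDiffOn hU hf ht).differentiableWithinAt)
    (fun t ht => ?_) hs ht
  ext1 v
  rw [pi_eq_sum_univ' v, map_sum]
  refine Finset.sum_eq_zero fun i _ => ?_
  rw [map_smul]
  have h1 := h0 i t ht
  rw [pderiv] at h1
  rw [h1, smul_zero]

theorem contDiffOn_xjet (hU : IsOpen U) (hu : ContDiffOn 𝕜 ∞ u U) (j : ℕ) :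
    ContDiffOn 𝕜 ∞ (fun t => xjet u t j) U := by
  induction j with
  | zero => exact hu
  | succ j ih =>
    have h1 := contDiffOn_pderiv hU ih 0
    refine h1.congr fun t _ => ?_
    rw [xjet, Function.iterate_succ_apply']
    rfl

theorem xjet_succ (u : (Fin (n + 1) → 𝕜) → ℂ) (t : Fin (n + 1) → 𝕜) (j : ℕ) :
    xjet u t (j + 1) = pderiv 0 (fun t => xjet u t j) t := by
  rw [xjet, Function.iterate_succ_apply']
  rfl

theorem contDiffOn_eval_xjet (hU : IsOpen U) (hu : ContDiffOn 𝕜 ∞ u U) (p : DiffPoly) :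
    ContDiffOn 𝕜 ∞ (fun t => MvPolynomial.eval (xjet u t) p) U := by
  induction p using MvPolynomial.induction_on with
  | C a => simpa using contDiffOn_const
  | add p q hp hq => simpa using hp.add hq
  | mul_X p j hp => simpa using hp.mul (contDiffOn_xjet hU hu j)

theorem pderiv_eval_xjet (hU : IsOpen U) (hu : ContDiffOn 𝕜 ∞ u U) (k : Fin (n + 1))
    {F : ℕ → DiffPoly} (hF : ∀ j, ∀ t ∈ U,
      pderiv k (fun t => xjet u t j) t = MvPolynomial.eval (xjet u t) (F j)) (p : DiffPoly) :
    ∀ t ∈ U, pderiv k (fun t => MvPolynomial.eval (xjet u t) p) t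
      = MvPolynomial.eval (xjet u t) (MvPolynomial.mkDerivation ℂ F p) := by
  intro t ht
  induction p using MvPolynomial.induction_on with
  | C a => simp [pderiv_const]
  | add p q hp hq =>
    simp only [map_add]
    rw [pderiv_add hU (contDiffOn_eval_xjet hU hu p) (contDiffOn_eval_xjet hU hu q) k ht, hp, hq]
  | mul_X p j hp =>
    simp only [map_mul, MvPolynomial.eval_X, Derivation.leibniz, MvPolynomial.mkDerivation_X,
      map_add, smul_eq_mul]
    rw [pderiv_mul hU (contDiffOn_eval_xjet hU hu p) (contDiffOn_xjet hU hu j) k ht, hp, hF j t ht]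

theorem pderiv_zero_eval_xjet (hU : IsOpen U) (hu : ContDiffOn 𝕜 ∞ u U) (p : DiffPoly) :
    ∀ t ∈ U, pderiv 0 (fun t => MvPolynomial.eval (xjet u t) p) t
      = MvPolynomial.eval (xjet u t) (DiffPoly.D p) :=
  pderiv_eval_xjet hU hu 0 (fun j t _ => by rw [MvPolynomial.eval_X, xjet_succ]) p

/-- Mixed partial derivatives commute, so the time derivative of u⁽ʲ⁾ is the j-th x-derivative of r;
the chain rule then gives the evolutionary derivation. -/
theorem pderiv_eval_xjet_evol (hU : IsOpen U) (hu : ContDiffOn 𝕜 ∞ u U) (k : Fin (n + 1))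
    {r : DiffPoly} (hr : ∀ t ∈ U, pderiv k u t = MvPolynomial.eval (xjet u t) r) (p : DiffPoly) :
    ∀ t ∈ U, pderiv k (fun t => MvPolynomial.eval (xjet u t) p) t
      = MvPolynomial.eval (xjet u t) (DiffPoly.evol r p) := by
  refine pderiv_eval_xjet hU hu k (fun j => ?_) p
  induction j with
  | zero => exact hr
  | succ j ih =>
    intro t ht
    have h1 : (fun t => xjet u t (j + 1)) = pderiv 0 fun t => xjet u t j :=
      funext fun t => xjet_succ u t j
    rw [h1, pderiv_comm hU (contDiffOn_xjet hU hu j) k 0 t ht, pderiv_congr hU ih 0 t ht,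
      pderiv_zero_eval_xjet hU hu _ t ht, Function.iterate_succ_apply']

theorem xjet_eq_eval (hU : IsOpen U) (hu : ContDiffOn 𝕜 ∞ u U) {p : DiffPoly}
    (hf : ∀ t ∈ U, f t = MvPolynomial.eval (xjet u t) p) (j : ℕ) :
    ∀ t ∈ U, xjet f t j = MvPolynomial.eval (xjet u t) (DiffPoly.D^[j] p) := by
  induction j with
  | zero => exact hf
  | succ j ih =>
    intro t ht
    rw [xjet_succ, pderiv_congr hU ih 0 t ht, pderiv_zero_eval_xjet hU hu _ t ht,
      Function.iterate_succ_apply']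

theorem eval_D_eq_zero (hU : IsOpen U) (hu : ContDiffOn 𝕜 ∞ u U) {p : DiffPoly} {c : ℂ}
    (hp : ∀ t ∈ U, MvPolynomial.eval (xjet u t) p = c) :
    ∀ t ∈ U, MvPolynomial.eval (xjet u t) (DiffPoly.D p) = 0 := fun t ht => by
  rw [← pderiv_zero_eval_xjet hU hu p t ht, pderiv_congr hU hp 0 t ht, pderiv_const]

theorem mem_jetIdeal_xjet (hU : IsOpen U) (hu : ContDiffOn 𝕜 ∞ u U) {p : DiffPoly}
    (hp : ∀ t ∈ U, MvPolynomial.eval (xjet u t) p = 0) :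
    ∀ t ∈ U, p ∈ DiffPoly.jetIdeal (MvPolynomial.eval (xjet u t)) := by
  have h1 (i : ℕ) : ∀ t ∈ U, MvPolynomial.eval (xjet u t) (DiffPoly.D^[i] p) = 0 := by
    induction i with
    | zero => exact hp
    | succ i ih =>
      intro t ht
      rw [Function.iterate_succ_apply']
      exact eval_D_eq_zero hU hu ih t ht
  exact fun t ht i => h1 i t ht

end Calculus

/-! ### Curve data for a function u: determination, existence and uniqueness. -/

section Curve

variable {𝕜 : Type*} [RCLike 𝕜] [NormedAlgebra 𝕜 ℂ] {n g : ℕ} {U : Set (Fin (n + 1) → 𝕜)}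
  {u : (Fin (n + 1) → 𝕜) → ℂ} {v : ℕ → (Fin (n + 1) → 𝕜) → ℂ} {a μ : ℕ → ℂ}

open DiffPoly

theorem coeff_curve_left (g : ℕ) (μ : ℕ → ℂ) (m : ℕ) :
    (4 * (Polynomial.C 4 + ∑ i ∈ Finset.Icc 1 (2 * g),
      Polynomial.C (μ i) * Polynomial.X ^ (i + 1)) : Polynomial ℂ).coeff m
      = if m ≤ 2 * g + 1 then coeff m (curveConst μ) else 0 := by
  rw [← map_ofNat (Polynomial.C (R := ℂ)), Polynomial.coeff_C_mul, Polynomial.coeff_add,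
    Polynomial.finsetSum_coeff, curveConst, PowerSeries.coeff_mk]
  simp only [Polynomial.coeff_C_mul, Polynomial.coeff_X_pow, Polynomial.coeff_C]
  match m with
  | 0 => simp; norm_num
  | 1 =>
    rw [Finset.sum_eq_zero fun i hi => ?_]
    · simp
    · rw [Finset.mem_Icc] at hi
      rw [if_neg (by omega), mul_zero]
  | m + 2 =>
    have h1 : ∀ i ∈ Finset.Icc 1 (2 * g), (μ i * if m + 2 = i + 1 then 1 else 0)
        = if i = m + 1 then μ i else 0 := fun i _ => by
      by_cases h : i = m + 1
      · simp [h]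
      · rw [if_neg (by omega), if_neg h, mul_zero]
    rw [Finset.sum_congr rfl h1, Finset.sum_ite_eq']
    simp only [Finset.mem_Icc]
    by_cases h : m + 2 ≤ 2 * g + 1
    · rw [if_pos h]; simp [show m < 2 * g by omega]
    · rw [if_neg h]; simp [show ¬m < 2 * g by omega]

theorem coeff_curveExpr_jets (t : Fin (n + 1) → 𝕜) (m : ℕ) :
    (curveExpr (u t) (genFun g fun i => xjet (v i) t 0) (genFun g fun i => xjet (v i) t 1)
      (genFun g fun i => xjet (v i) t 2)).coeff m
    = coeff m (curveSeries (u t)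
        (2 - ((genFun g fun i => xjet (v i) t 0 : Polynomial ℂ) : ℂ⟦X⟧))
        (-((genFun g fun i => xjet (v i) t 1 : Polynomial ℂ) : ℂ⟦X⟧))
        (-((genFun g fun i => xjet (v i) t 2 : Polynomial ℂ) : ℂ⟦X⟧))) := by
  rw [← Polynomial.coeff_coe, coe_curveExpr]

theorem coeff_two_sub_genFun {R : Type*} [CommRing R] (g : ℕ) (w : ℕ → R) (k : ℕ) :
    coeff k (2 - (genFun g w : Polynomial R) : R⟦X⟧)
      = if k = 0 then 2 else if k ≤ g then -w k else 0 := by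
  rw [map_sub, Polynomial.coeff_coe, coeff_genFun, ← map_ofNat (PowerSeries.C (R := R)),
    PowerSeries.coeff_C]
  rcases Nat.eq_zero_or_pos k with rfl | hk
  · simp
  · rw [if_neg hk.ne', if_neg hk.ne', zero_sub]
    by_cases h : k ≤ g
    · rw [if_pos ⟨hk, h⟩, if_pos h]
    · rw [if_neg (by omega), if_neg h, neg_zero]

theorem D_two : D (2 : DiffPoly) = 0 := by simpa using D.map_natCast 2

/-- The bound m lets this serve inside the induction of `eq_Theta`, where only the functions of
smaller index are known. -/
theorem jets_eq_map (hU : IsOpen U) (hu : ContDiffOn 𝕜 ∞ u U) {w : ℕ → DiffPoly} {m : ℕ}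
    (hv : ∀ k ∈ Finset.Icc 1 g, k < m → ∀ t ∈ U, v k t = MvPolynomial.eval (xjet u t) (w k))
    {t : Fin (n + 1) → 𝕜} (ht : t ∈ U) :
    (∀ i < m, coeff i (2 - ((genFun g fun i => xjet (v i) t 0 : Polynomial ℂ) : ℂ⟦X⟧))
      = coeff i (PowerSeries.map (MvPolynomial.eval (xjet u t))
        (2 - (genFun g w : Polynomial DiffPoly)))) ∧
    (∀ i < m, coeff i (-((genFun g fun i => xjet (v i) t 1 : Polynomial ℂ) : ℂ⟦X⟧))
      = coeff i (PowerSeries.map (MvPolynomial.eval (xjet u t))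
        (seriesDer D (2 - (genFun g w : Polynomial DiffPoly))))) ∧
    (∀ i < m, coeff i (-((genFun g fun i => xjet (v i) t 2 : Polynomial ℂ) : ℂ⟦X⟧))
      = coeff i (PowerSeries.map (MvPolynomial.eval (xjet u t))
        (seriesDer D (seriesDer D (2 - (genFun g w : Polynomial DiffPoly)))))) := by
  have hj (j : ℕ) : ∀ k ∈ Finset.Icc 1 g, k < m →
      xjet (v k) t j = MvPolynomial.eval (xjet u t) (D^[j] (w k)) :=
    fun k hk hkm => xjet_eq_eval hU hu (hv k hk hkm) j t ht
  simp only [Finset.mem_Icc] at hj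
  refine ⟨fun i hi => ?_, fun i hi => ?_, fun i hi => ?_⟩
  · rw [PowerSeries.coeff_map, coeff_two_sub_genFun, coeff_two_sub_genFun]
    split_ifs with h0 hg
    · rw [map_ofNat]
    · rw [hj 0 i ⟨by omega, hg⟩ hi, map_neg]; rfl
    · rw [map_zero]
  · rw [PowerSeries.coeff_map, coeff_seriesDer, coeff_two_sub_genFun, map_neg,
      Polynomial.coeff_coe, coeff_genFun]
    split_ifs with h1 h0 hg h2 h3
    · omega
    · rw [hj 1 i h1 hi, map_neg, map_neg]; rfl
    · omega
    · rw [D_two, map_zero, neg_zero]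
    · omega
    · rw [map_zero, map_zero, neg_zero]
  · rw [PowerSeries.coeff_map, coeff_seriesDer, coeff_seriesDer, coeff_two_sub_genFun, map_neg,
      Polynomial.coeff_coe, coeff_genFun]
    split_ifs with h1 h0 hg h2 h3
    · omega
    · rw [hj 2 i h1 hi, map_neg, map_neg, map_neg]; rfl
    · omega
    · rw [D_two, map_zero, map_zero, neg_zero]
    · omega
    · rw [map_zero, map_zero, map_zero, neg_zero]

theorem coeff_curveExpr_of_eq (hU : IsOpen U) (hu : ContDiffOn 𝕜 ∞ u U) {w : ℕ → DiffPoly}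
    (hv : ∀ k ∈ Finset.Icc 1 g, ∀ t ∈ U, v k t = MvPolynomial.eval (xjet u t) (w k))
    {t : Fin (n + 1) → 𝕜} (ht : t ∈ U) (m : ℕ) :
    (curveExpr (u t) (genFun g fun i => xjet (v i) t 0) (genFun g fun i => xjet (v i) t 1)
      (genFun g fun i => xjet (v i) t 2)).coeff m
    = MvPolynomial.eval (xjet u t)
        (coeff m (curveForm (2 - (genFun g w : Polynomial DiffPoly)))) := by
  obtain ⟨h0, h1, h2⟩ := jets_eq_map (m := m + 1) hU hu (fun k hk _ => hv k hk) ht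
  rw [coeff_curveExpr_jets, coeff_curveSeries_congr _ h0 (fun i hi => h1 i (by omega))
    (fun i hi => h2 i (by omega)), ← PowerSeries.coeff_map, curveForm, map_curveSeries,
    MvPolynomial.eval_X]
  rfl

namespace IsCurveData

theorem coeff_eq (hd : IsCurveData g U u v μ) {t : Fin (n + 1) → 𝕜} (ht : t ∈ U) {m : ℕ} :
    (curveExpr (u t) (genFun g fun i => xjet (v i) t 0) (genFun g fun i => xjet (v i) t 1)
      (genFun g fun i => xjet (v i) t 2)).coeff m
      = if m ≤ 2 * g + 1 then coeff m (curveConst μ) else 0 := by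
  rw [← hd.equation t ht, coeff_curve_left]

/-- At order k the data and the truncated Θ-series have the same constant as coefficient and the
same lower terms, so 16(Θ_k - v_k) = 0. -/
theorem eq_Theta (hU : IsOpen U) (hu : ContDiffOn 𝕜 ∞ u U) (hd : IsCurveData g U u v μ) :
    ∀ k ∈ Finset.Icc 1 g, ∀ t ∈ U, v k t = MvPolynomial.eval (xjet u t) (Theta μ k) := by
  intro k
  induction k using Nat.strong_induction_on with
  | _ k ih =>
    intro hk t ht
    rw [Finset.mem_Icc] at hk
    obtain ⟨h0, h1, h2⟩ := jets_eq_map (g := g) (m := k) hU hu (fun i hi hik => ih i hik hi) ht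
    have h3 := coeff_curveSeries_sub (u t) (by omega) h0 h1 h2
    have h4 : coeff k (curveForm (2 - (genFun g (Theta μ) : Polynomial DiffPoly)))
        = MvPolynomial.C (coeff k (curveConst μ)) := by
      rw [coeff_curveForm_congr (G := thetaSeries μ) fun i hi =>
        coeff_two_sub_genFun_Theta μ (by omega), curveForm_thetaSeries, PowerSeries.coeff_map,
        MvPolynomial.algebraMap_eq]
    have h5 : curveSeries (u t) (PowerSeries.map (MvPolynomial.eval (xjet u t))
        (2 - (genFun g (Theta μ) : Polynomial DiffPoly))) (PowerSeries.map
        (MvPolynomial.eval (xjet u t)) (seriesDer D (2 - (genFun g (Theta μ) :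
        Polynomial DiffPoly)))) (PowerSeries.map (MvPolynomial.eval (xjet u t))
        (seriesDer D (seriesDer D (2 - (genFun g (Theta μ) : Polynomial DiffPoly)))))
        = PowerSeries.map (MvPolynomial.eval (xjet u t))
          (curveForm (2 - (genFun g (Theta μ) : Polynomial DiffPoly))) := by
      rw [curveForm, map_curveSeries, MvPolynomial.eval_X]
      rfl
    rw [← coeff_curveExpr_jets, hd.coeff_eq ht, if_pos (by omega), h5, PowerSeries.coeff_map, h4,
      MvPolynomial.eval_C, sub_self, PowerSeries.coeff_map, PowerSeries.coeff_map] at h3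
    simp only [coeff_two_sub_genFun, if_true, if_neg (show k ≠ 0 by omega), if_pos hk.2, map_ofNat,
      map_neg] at h3
    have h6 : xjet (v k) t 0 = v k t := rfl
    rw [h6] at h3
    linear_combination h3 / 16

/-- On the jets of u the form of the truncation T is constant, so T·Λ(T) evaluates to zero and the
factor T cancels in the domain ℂ⟦ξ⟧. The defect of T at order g + 1 is 4DΘ_{g+1}. -/
theorem eval_D_Theta_succ (hU : IsOpen U) (hu : ContDiffOn 𝕜 ∞ u U)
    (hd : IsCurveData g U u v μ) {t : Fin (n + 1) → 𝕜} (ht : t ∈ U) :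
    MvPolynomial.eval (xjet u t) (D (Theta μ (g + 1))) = 0 := by
  obtain ⟨T, hT⟩ : ∃ T : DiffPoly⟦X⟧, T = 2 - (genFun g (Theta μ) : Polynomial DiffPoly) :=
    ⟨_, rfl⟩
  have hle {i : ℕ} (hi : i ≤ g) : coeff i T = coeff i (thetaSeries μ) := by
    rw [hT, coeff_two_sub_genFun_Theta μ hi]
  have h1 : PowerSeries.map (MvPolynomial.eval (xjet u t)) (seriesDer D (curveForm T)) = 0 := by
    ext1 m
    rw [PowerSeries.coeff_map, coeff_seriesDer, map_zero]
    refine eval_D_eq_zero hU hu (c := if m ≤ 2 * g + 1 then coeff m (curveConst μ) else 0)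
      (fun t ht => ?_) t ht
    rw [hT, ← coeff_curveExpr_of_eq hU hu (hd.eq_Theta hU hu) ht, hd.coeff_eq ht]
  rw [seriesDer_curveForm, map_mul] at h1
  have h2 : PowerSeries.map (MvPolynomial.eval (xjet u t)) (2 * T) ≠ 0 := fun h => by
    have h3 := congrArg (coeff 0) h
    rw [PowerSeries.coeff_map, ← map_ofNat (PowerSeries.C (R := DiffPoly)),
      PowerSeries.coeff_C_mul, hle (Nat.zero_le _), coeff_zero_thetaSeries, map_mul, map_ofNat,
      map_zero] at h3
    norm_num at h3
  have h3 := congrArg (coeff (g + 1)) ((mul_eq_zero.1 h1).resolve_left h2)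
  have h4 := coeff_succ_lenard (thetaSeries μ) g
  have h5 : coeff (g + 1) T = 0 := by
    rw [hT, coeff_two_sub_genFun, if_neg (by omega), if_neg (by omega)]
  rw [lenard_thetaSeries, map_zero, coeff_thetaSeries μ (Nat.succ_ne_zero g), map_neg] at h4
  have h6 : coeff (g + 1) (lenard T) = 4 * D (Theta μ (g + 1)) := by
    rw [coeff_succ_lenard, h5, hle le_rfl, map_zero]
    linear_combination -h4
  rw [PowerSeries.coeff_map, h6, map_mul, map_ofNat, map_zero] at h3
  exact (mul_eq_zero.1 h3).resolve_left (by norm_num)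

theorem mu_eq_muOfConstants (hU : IsOpen U) (hu : ContDiffOn 𝕜 ∞ u U)
    (huniq : ∀ b : ℕ → ℂ, IsStationarySolution g b U u → ∀ k < g - 1, b k = a k)
    (hd : IsCurveData g U u v μ) : ∀ k ∈ Finset.Icc 1 (g - 1), μ k = muOfConstants g a k := by
  -- These are the constants for which the curve makes u stationary; the indices k < g - 1
  -- correspond to the coefficients of order at least 2.
  obtain ⟨b, hb'⟩ : ∃ b : ℕ → ℂ, ∀ k, b k = coeff (g - k) (rootSeries μ) := ⟨_, fun _ => rfl⟩
  have hb : ∀ i ∈ Finset.Icc 2 g, coeff i (rootSeries μ) = b (g - i) := fun i hi => by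
    rw [hb', Nat.sub_sub_self (Finset.mem_Icc.1 hi).2]
  have h1 := huniq b (fun t ht => by
    rw [← flow_self, ← D_Theta_succ_eq_flow hb le_rfl]
    exact hd.eval_D_Theta_succ hU hu ht)
  refine (mu_eq_muOfConstants_iff g a μ).2 fun i hi => ?_
  rw [hb i hi]
  rw [Finset.mem_Icc] at hi
  exact h1 (g - i) (by omega)

theorem pderiv_eq (hU : IsOpen U) (hu : ContDiffOn 𝕜 ∞ u U) (hn : n + 1 ≤ g)
    (hflow : FollowsFlows g a U u) (hd : IsCurveData g U u v μ)
    (hμ : ∀ k ∈ Finset.Icc 1 (g - 1), μ k = muOfConstants g a k) (k : Fin (n + 1)) :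
    ∀ t ∈ U, pderiv k u t = pderiv 0 (v (k + 1)) t := fun t ht => by
  have hk := k.2
  rw [pderiv_congr hU (hd.eq_Theta hU hu (k + 1) (by simp; omega)) 0 t ht,
    pderiv_zero_eval_xjet hU hu _ t ht,
    D_Theta_succ_eq_flow ((mu_eq_muOfConstants_iff g a μ).1 hμ) (by omega), hflow k t ht]

theorem mu_eq_muOfInitialValues (hU : IsOpen U) (hu : ContDiffOn 𝕜 ∞ u U)
    (hd : IsCurveData g U u v μ)
    (hμ : ∀ k ∈ Finset.Icc 1 (g - 1), μ k = muOfConstants g a k) (hg : 1 ≤ g) :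
    ∀ k ∈ Finset.Icc g (2 * g), ∀ t ∈ U, μ k = muOfInitialValues g a (xjet u t) k := by
  intro k hk t ht
  rw [Finset.mem_Icc] at hk
  have h1 := hd.coeff_eq ht (m := k + 1)
  rw [coeff_curveExpr_of_eq hU hu (hd.eq_Theta hU hu) ht, ← curveCoeff_eq, if_pos (by omega),
    curveConst, PowerSeries.coeff_mk, if_neg (by omega), if_neg (by omega),
    Nat.add_sub_cancel] at h1
  have h2 : curveCoeff g (Theta (muOfConstants g a)) k = curveCoeff g (Theta μ) k := by
    rw [curveCoeff_eq, curveCoeff_eq, genFun_congr fun i hi => ?_]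
    refine Theta_congr fun j hj => (hμ j ?_).symm
    rw [Finset.mem_Icc] at hi hj ⊢
    omega
  rw [muOfInitialValues, h2, h1]
  ring

end IsCurveData

theorem natDegree_genFun_le {R : Type*} [CommRing R] (g : ℕ) (w : ℕ → R) :
    (genFun g w).natDegree ≤ g :=
  Polynomial.natDegree_le_iff_coeff_eq_zero.2 fun i hi => by
    rw [coeff_genFun, if_neg (by omega)]

/-- This settles all coefficients beyond those that carry some μ_k. -/
theorem natDegree_curveExpr_le {R : Type*} [CommRing R] (u₁ : R) {w w₁ w₂ : Polynomial R}
    (h : w.natDegree ≤ g) (h₁ : w₁.natDegree ≤ g) (h₂ : w₂.natDegree ≤ g) :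
    (curveExpr u₁ w w₁ w₂).natDegree ≤ 2 * g + 1 := by
  have hw : (2 - w).natDegree ≤ g := by
    refine (Polynomial.natDegree_sub_le _ _).trans (max_le ?_ h)
    rw [← map_ofNat (Polynomial.C (R := R)), Polynomial.natDegree_C]
    exact Nat.zero_le _
  have h2 : (2 * w₂).natDegree ≤ g := by
    rw [← map_ofNat (Polynomial.C (R := R))]
    exact (Polynomial.natDegree_C_mul_le _ _).trans h₂
  have h3 : (4 * (1 + Polynomial.C u₁ * Polynomial.X)).natDegree ≤ 1 := by
    rw [← map_ofNat (Polynomial.C (R := R))]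
    refine (Polynomial.natDegree_C_mul_le _ _).trans ((Polynomial.natDegree_add_le _ _).trans ?_)
    rw [Polynomial.natDegree_one]
    exact max_le (Nat.zero_le _)
      ((Polynomial.natDegree_C_mul_le _ _).trans Polynomial.natDegree_X_le)
  have h4 : (w₁ ^ 2 + 2 * w₂ * (2 - w)).natDegree ≤ 2 * g := by
    refine (Polynomial.natDegree_add_le _ _).trans (max_le ?_ ?_)
    · exact Polynomial.natDegree_pow_le_of_le 2 h₁
    · exact (Polynomial.natDegree_mul_le_of_le h2 hw).trans (by omega)
  refine (Polynomial.natDegree_add_le _ _).trans (max_le ?_ ?_)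
  · exact (Polynomial.natDegree_mul_le_of_le Polynomial.natDegree_X_le h4).trans (by omega)
  · exact (Polynomial.natDegree_mul_le_of_le h3
      (Polynomial.natDegree_pow_le_of_le 2 hw)).trans (by omega)

theorem exists_isCurveData (hU : IsOpen U) (hUc : IsConnected U) (hu : ContDiffOn 𝕜 ∞ u U)
    (hn : n + 1 ≤ g) (hstat : IsStationarySolution g a U u) (hflow : FollowsFlows g a U u) :
    ∃ (v : ℕ → (Fin (n + 1) → 𝕜) → ℂ) (μ : ℕ → ℂ), IsCurveData g U u v μ ∧
      ∀ k ∈ Finset.Icc 1 (g - 1), μ k = muOfConstants g a k := by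
  obtain ⟨t₀, ht₀⟩ := hUc.nonempty
  obtain ⟨μ, hμ⟩ : ∃ μ : ℕ → ℂ, ∀ k, μ k = if k < g then muOfConstants g a k
      else muOfInitialValues g a (xjet u t₀) k := ⟨_, fun _ => rfl⟩
  have hμ1 : ∀ k ∈ Finset.Icc 1 (g - 1), μ k = muOfConstants g a k := fun k hk => by
    rw [Finset.mem_Icc] at hk
    rw [hμ, if_pos (by omega)]
  have hroot := (mu_eq_muOfConstants_iff g a μ).1 hμ1
  refine ⟨fun k t => MvPolynomial.eval (xjet u t) (Theta μ k), μ,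
    ⟨fun i _ => contDiffOn_eval_xjet hU hu _, fun t _ => ?_, fun t ht => ?_⟩, hμ1⟩
  · rw [Theta, MvPolynomial.eval_X]; rfl
  · ext1 m
    rw [coeff_curve_left]
    split_ifs with hm
    · rw [coeff_curveExpr_of_eq (w := Theta μ) hU hu (fun _ _ _ _ => rfl) ht]
      by_cases hmg : m ≤ g
      · rw [coeff_curveForm_congr (G := thetaSeries μ) fun i hi =>
          coeff_two_sub_genFun_Theta μ (by omega), curveForm_thetaSeries, PowerSeries.coeff_map,
          MvPolynomial.algebraMap_eq, MvPolynomial.eval_C]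
      · obtain ⟨k, rfl⟩ : ∃ k, m = k + 1 := ⟨m - 1, by omega⟩
        rw [← curveCoeff_eq, curveConst, PowerSeries.coeff_mk, if_neg (by omega),
          if_neg (by omega), Nat.add_sub_cancel, hμ, if_neg (by omega), muOfInitialValues]
        have h2 : curveCoeff g (Theta (muOfConstants g a)) k = curveCoeff g (Theta μ) k := by
          rw [curveCoeff_eq, curveCoeff_eq, genFun_congr fun i hi => ?_]
          refine Theta_congr fun j hj => (hμ1 j ?_).symm
          rw [Finset.mem_Icc] at hi hj ⊢
          omega
        -- For orders above g the Θ-recursion gives nothing. Constancy on the connected set U comes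
        -- from the flows, the x-direction being the flow number 0.
        have h3 := eq_of_pderiv_eq_zero hU hUc
          (contDiffOn_eval_xjet hU hu (curveCoeff g (Theta μ) k)) (fun l t ht => by
            rw [pderiv_eval_xjet_evol hU hu l (hflow l) _ t ht]
            exact eval_evol_flow_curveCoeff hroot _ (fun c => MvPolynomial.eval_C c)
              (mem_jetIdeal_xjet hU hu hstat t ht) (by have := l.2; omega) k) ht₀ ht
        rw [h2, ← h3]
        ring
    · exact (Polynomial.coeff_eq_zero_of_natDegree_lt (lt_of_le_of_lt
        (natDegree_curveExpr_le _ (natDegree_genFun_le g _) (natDegree_genFun_le g _)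
          (natDegree_genFun_le g _)) (not_le.1 hm))).symm

theorem hyperellipticCurve_congr {μ ν : ℕ → ℂ} (h : ∀ i ∈ Finset.Icc 1 (2 * g), μ i = ν i) :
    hyperellipticCurve g μ = hyperellipticCurve g ν := by
  ext q
  rw [hyperellipticCurve, hyperellipticCurve, Set.mem_ofPred_eq, Set.mem_ofPred_eq,
    Finset.sum_congr rfl fun i hi => by rw [h i hi]]

end Curve

theorem mainTheorem3 {𝕜 : Type*} [RCLike 𝕜] [NormedAlgebra 𝕜 ℂ]
    (g n : ℕ) (hn : n + 1 ≤ g) (a : ℕ → ℂ)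
    (U : Set (Fin (n + 1) → 𝕜)) (hU : IsOpen U) (hUc : IsConnected U)
    (u : (Fin (n + 1) → 𝕜) → ℂ) (hu : ContDiffOn 𝕜 ∞ u U)
    (hstat : IsStationarySolution g a U u) (hflow : FollowsFlows g a U u) :
    -- the curve exists and is unique
    (∃! Γ : Set (ℂ × ℂ), ∃ (v : ℕ → (Fin (n + 1) → 𝕜) → ℂ) (μ : ℕ → ℂ),
      IsCurveData g U u v μ ∧ (∀ k ∈ Finset.Icc 1 (g - 1), μ k = muOfConstants g a k) ∧
      Γ = hyperellipticCurve g μ) ∧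
    -- all the data of the curve are determined by the constants and by initial values
    (∀ (v : ℕ → (Fin (n + 1) → 𝕜) → ℂ) (μ : ℕ → ℂ), IsCurveData g U u v μ →
      (∀ k ∈ Finset.Icc 1 (g - 1), μ k = muOfConstants g a k) →
      (∀ k ∈ Finset.Icc 1 g, ∀ t ∈ U,
        v k t = MvPolynomial.eval (xjet u t) (DiffPoly.Theta μ k)) ∧
      (∀ k : Fin (n + 1), ∀ t ∈ U, pderiv k u t = pderiv 0 (v (k + 1)) t) ∧
      (∀ k ∈ Finset.Icc g (2 * g), ∀ t₀ ∈ U, μ k = muOfInitialValues g a (xjet u t₀) k)) ∧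
    -- if `u` determines its constants, the relation between them and the curve is automatic
    ((∀ b : ℕ → ℂ, IsStationarySolution g b U u → ∀ k < g - 1, b k = a k) →
      ∀ (v : ℕ → (Fin (n + 1) → 𝕜) → ℂ) (μ : ℕ → ℂ), IsCurveData g U u v μ →
        ∀ k ∈ Finset.Icc 1 (g - 1), μ k = muOfConstants g a k) := by
  refine ⟨?_, fun v μ hd hμ => ⟨hd.eq_Theta hU hu, hd.pderiv_eq hU hu hn hflow hμ,
    hd.mu_eq_muOfInitialValues hU hu hμ (by omega)⟩,
    fun huniq v μ hd => hd.mu_eq_muOfConstants hU hu huniq⟩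
  obtain ⟨v, μ, hd, hμ⟩ := exists_isCurveData hU hUc hu hn hstat hflow
  obtain ⟨t₀, ht₀⟩ := hUc.nonempty
  refine ⟨_, ⟨v, μ, hd, hμ, rfl⟩, ?_⟩
  rintro _ ⟨v', μ', hd', hμ', rfl⟩
  refine hyperellipticCurve_congr fun i hi => ?_
  rw [Finset.mem_Icc] at hi
  -- Equality of the curves is proved through their coefficients: below g they are given by a, from
  -- g on by the jet of u at one common point.
  by_cases hig : i < g
  · rw [hμ i (by simp; omega), hμ' i (by simp; omega)]
  · rw [hd.mu_eq_muOfInitialValues hU hu hμ (by omega) i (by simp; omega) t₀ ht₀,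
      hd'.mu_eq_muOfInitialValues hU hu hμ' (by omega) i (by simp; omega) t₀ ht₀]

end
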